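/- **Proposition 1.4 (Hashimoto).** Let $P=\mathbb{P}^N(\mathbb{C})$, let $S=\mathbb{C}[Z_0,\dots,Z_N]$ be its homogeneous coordinate ring and $S_+=(Z_0,\dots,Z_N)$. For a closed subscheme $V\subseteq P$ with ideal sheaf $I_V$, put $\mathbb{I}_V=\bigoplus_{m\ge 0}H^0(P,I_V(m))\subseteq S$ and $R_V=S/\mathbb{I}_V$; call $V$ arithmetically Cohen–Macaulay if $R_V$ is a Cohen–Macaulay ring. For closed subschemes $V\subseteq W$ of $P$, call $W$ a PG-shell (pregeometric shell) of $V$ if the natural map $$\mathrm{Tor}^S_q(R_W,S/S_+)\longrightarrow \mathrm{Tor}^S_q(R_V,S/S_+)$$ is injective for every $q\ge 1$. Let $Y$ and $Z$ be arithmetically Cohen–Macaulay closed subschemes of $P$ whose scheme-theoretic intersection $X=Y\cap Z$ is nonempty and satisfies $$\operatorname{codim}(X,P)=\operatorname{codim}(Y,P)+\operatorname{codim}(Z,P).$$ Then both $Y$ and $Z$ are PG-shells of $X$. -/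

import Mathlib

open AlgebraicGeometry CategoryTheory

noncomputable section

namespace PGShell

/-- The homogeneous coordinate ring `S = ℂ[Z₀, …, Z_N]` of `ℙ^N`. -/
abbrev S (N : ℕ) : Type := MvPolynomial (Fin (N + 1)) ℂ

/-- The standard grading of `S` by total degree. -/
abbrev grading (N : ℕ) : ℕ → Submodule ℂ (S N) :=
  MvPolynomial.homogeneousSubmodule (Fin (N + 1)) ℂ

instance gradedRing_grading (N : ℕ) : GradedRing (grading N) :=
  MvPolynomial.gradedAlgebra

/-- The complex projective space `ℙ^N` as a scheme. -/
abbrev ProjSpace (N : ℕ) : Scheme.{0} := Proj (grading N)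

/-- Closed subschemes of `ℙ^N`, given by their (quasi-coherent) ideal sheaves. The order is the
inclusion of ideal sheaves, hence the *reverse* of the inclusion of closed subschemes. -/
abbrev ClosedSubscheme (N : ℕ) : Type := (ProjSpace N).IdealSheafData

/-- The coordinate `Z_i` is homogeneous of degree one. -/
theorem X_mem_grading {N : ℕ} (i : Fin (N + 1)) :
    (MvPolynomial.X i : S N) ∈ grading N 1 :=
  MvPolynomial.isHomogeneous_X ℂ i

/-- The standard affine chart `D₊(Z_i)` of `ℙ^N`. -/
def chart {N : ℕ} (i : Fin (N + 1)) : (ProjSpace N).affineOpens :=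
  ⟨Proj.basicOpen (grading N) (MvPolynomial.X i),
    Proj.isAffineOpen_basicOpen (grading N) (MvPolynomial.X i) (X_mem_grading i) Nat.one_pos⟩

/-- For a form `f` of degree `m`, regarded as a global section of `𝒪(m)`, the function `f / Z_i ^ m`
on `D₊(Z_i)`: it corresponds to `f` under the trivialization of `𝒪(m)` by `Z_i ^ m`. -/
def dehomogenize {N m : ℕ} (i : Fin (N + 1)) (f : S N) (hf : f ∈ grading N m) :
    Γ(ProjSpace N, (chart i).1) :=
  (Proj.awayToSection (grading N) (MvPolynomial.X i)).hom
    (HomogeneousLocalization.Away.mk (grading N) (X_mem_grading i) m f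
      (by simpa only [smul_eq_mul, mul_one] using hf))

/-- The homogeneous ideal `⨁_m H⁰(ℙ^N, I_V(m))` of a closed subscheme `V`, where `I_V` is its ideal
sheaf. A form `f` of degree `m` is a section of `I_V(m)` if and only if its trivialization
`f / Z_i ^ m` is a section of `I_V` on each of the charts `D₊(Z_i)`. -/
def homogeneousIdeal {N : ℕ} (V : ClosedSubscheme N) : Ideal (S N) :=
  Ideal.span {f | ∃ (m : ℕ) (hf : f ∈ grading N m),
    ∀ i : Fin (N + 1), dehomogenize i f hf ∈ V.ideal (chart i)}

theorem homogeneousIdeal_mono {N : ℕ} {V W : ClosedSubscheme N} (h : W ≤ V) :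
    homogeneousIdeal W ≤ homogeneousIdeal V :=
  Ideal.span_mono fun _ ⟨m, hf, hi⟩ => ⟨m, hf, fun i => h (chart i) (hi i)⟩

/-- The homogeneous coordinate ring `R_V = S / ⨁_m H⁰(ℙ^N, I_V(m))`. -/
abbrev CoordRing {N : ℕ} (V : ClosedSubscheme N) : Type := S N ⧸ homogeneousIdeal V

/-- The natural `S`-linear surjection `R_W → R_V` for closed subschemes `V ⊆ W`. -/
def coordRingMap {N : ℕ} {V W : ClosedSubscheme N} (h : W ≤ V) :
    ModuleCat.of (S N) (CoordRing W) ⟶ ModuleCat.of (S N) (CoordRing V) :=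
  ModuleCat.ofHom (Submodule.factor (homogeneousIdeal_mono h))

/-- The module `S / S₊`, where `S₊ = (Z₀, …, Z_N)` is the irrelevant ideal. -/
abbrev resField (N : ℕ) : ModuleCat.{0} (S N) :=
  ModuleCat.of (S N) (S N ⧸ (HomogeneousIdeal.irrelevant (grading N)).toIdeal)

/-- The natural map `Tor^S_q(R_W, S / S₊) → Tor^S_q(R_V, S / S₊)` for closed subschemes `V ⊆ W`.
`Tor' (ModuleCat S) q` is the `q`-th left derived functor of `- ⊗ M`, in its first argument. -/
def torMap {N : ℕ} {V W : ClosedSubscheme N} (h : W ≤ V) (q : ℕ) :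
    ((Tor' (ModuleCat.{0} (S N)) q).obj (ModuleCat.of (S N) (CoordRing W))).obj (resField N) ⟶
      ((Tor' (ModuleCat.{0} (S N)) q).obj (ModuleCat.of (S N) (CoordRing V))).obj (resField N) :=
  ((Tor' (ModuleCat.{0} (S N)) q).map (coordRingMap h)).app (resField N)

/-- `W` is a pregeometric shell (PG-shell) of `V`: `V` is a closed subscheme of `W`, and the
natural map `Tor^S_q(R_W, S / S₊) → Tor^S_q(R_V, S / S₊)` is injective for all `q ≥ 1`. -/
def IsPGShell {N : ℕ} (W V : ClosedSubscheme N) : Prop :=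
  ∃ h : W ≤ V, ∀ q : ℕ, 1 ≤ q → Function.Injective (torMap h q)

/-- The scheme-theoretic intersection, whose ideal sheaf is the sum of the two ideal sheaves. -/
def inter {N : ℕ} (Y Z : ClosedSubscheme N) : ClosedSubscheme N := Y ⊔ Z

/-- The codimension of a closed subscheme in `ℙ^N`: the infimum over its points `x` of the
codimension of the closure of `x` in `ℙ^N`, which is the dimension of the local ring of `ℙ^N`
at `x`. (It is `⊤` for the empty subscheme.) -/
def codim {N : ℕ} (V : ClosedSubscheme N) : ℕ∞ :=
  ⨅ x ∈ V.support, Order.coheight x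

/-- A local ring is Cohen–Macaulay if it is Noetherian and its depth equals its Krull dimension,
that is, its maximal ideal contains a regular sequence whose length is the dimension. -/
def IsCohenMacaulayLocalRing (R : Type*) [CommRing R] [IsLocalRing R] : Prop :=
  IsNoetherianRing R ∧ ∃ rs : List R, (∀ r ∈ rs, r ∈ IsLocalRing.maximalIdeal R) ∧
    RingTheory.Sequence.IsRegular R rs ∧ ((rs.length : ℕ∞) : WithBot ℕ∞) = ringKrullDim R

/-- A ring is Cohen–Macaulay if it is Noetherian and all its localizations at prime ideals are
Cohen–Macaulay local rings. -/
def IsCohenMacaulayRing (R : Type*) [CommRing R] : Prop :=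
  IsNoetherianRing R ∧
    ∀ (p : Ideal R) [p.IsPrime], IsCohenMacaulayLocalRing (Localization.AtPrime p)

/-- A closed subscheme of `ℙ^N` is arithmetically Cohen–Macaulay if its homogeneous coordinate ring
is a Cohen–Macaulay ring. -/
def IsArithmeticallyCohenMacaulay {N : ℕ} (V : ClosedSubscheme N) : Prop :=
  IsCohenMacaulayRing (CoordRing V)

end PGShell

end

/-! Let I, J, K be the homogeneous ideals of Y, Z and X, let 𝔪 = S₊ and k = S/𝔪, and put R = S_𝔪, M
= (S/I)_𝔪, B = (S/J)_𝔪. The map Tor(S/I, k) → Tor(S/K, k) has a left inverse. Two facts suffice: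
Tor_i(S/I, B) = 0 for i ≥ 1, and the canonical map S/I → S/I ⊗ B factors through S/K. Let P and Q be
projective resolutions of S/I and S/K. By the first fact P ⊗ B resolves S/I ⊗ B, so the
factorization lifts to a chain map Q → P ⊗ B whose composite with P → Q is homotopic to the
canonical map P → P ⊗ B. After tensoring with k this last map is split, since B acts on k through B
→ k (`mono_tor'_map`).

Both facts come from proper intersection over the regular local ring R. Tor is handled through its
dual Ext_R(M, B*), where B* is the character module of B. If B has depth q, then B* has injective
dimension at most N + 1 - q (`HasRegularSequence.ext_residueModule_dualModule_eq_zero`,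
`ext_dualModule_eq_zero`). Each unit by which the depth of M exceeds the dimension of the
intersection provides an M-regular element killing B, and so lowers by one the degree above which
Ext vanishes (`HasRegularSequence.ext_dualModule_eq_zero`). The Cohen–Macaulay hypotheses and the
codimension equality make this excess at least N + 1 - q, so Ext vanishes in all positive degrees.

Since X is nonempty, its affine cone has dimension at least 1. This leaves room for some y ∈ 𝔪
acting injectively on S/I ⊗ B (`HasRegularSequence.exists_smul_hom_surjective`). Every f ∈ K is
carried into I + J by a power of y (`exists_pow_mul_mem_sup`), so K kills 1 ⊗ 1, which is the second
fact. Codimensions in projective space are converted to dimensions over R by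
`coheight_eq_height_pointIdeal`, `le_add_codim` and `coheight_le_of_codim`. -/

namespace PGShell

/-! ### Lifting chain maps, and a splitting criterion for maps on Tor -/

section CategoryTheory

open Limits MonoidalCategory

section Lifting

variable {C : Type*} [Category C] [Abelian C]

/-- A morphism out of the augmentation of a complex of projectives lifts to a chain map into
an exact augmented complex. -/
theorem exists_chainMap_of_exact {P K : ChainComplex C ℕ} [∀ n, Projective (P.X n)] {W : C}
    (ε : K.X 0 ⟶ W) [Epi ε] (hε : K.d 1 0 ≫ ε = 0)
    (h0 : (ShortComplex.mk _ _ hε).Exact)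
    (hK : ∀ n, (ShortComplex.mk (K.d (n + 2) (n + 1)) (K.d (n + 1) n) (by simp)).Exact)
    (f : P.X 0 ⟶ W) (hf : P.d 1 0 ≫ f = 0) :
    ∃ h : P ⟶ K, h.f 0 ≫ ε = f := by
  let f0 : P.X 0 ⟶ K.X 0 := Projective.factorThru f ε
  have hf0 : f0 ≫ ε = f := Projective.factorThru_comp _ _
  let f1 : P.X 1 ⟶ K.X 1 := h0.liftFromProjective (P.d 1 0 ≫ f0) (by simp [hf0, hf])
  have hf1 : f1 ≫ K.d 1 0 = P.d 1 0 ≫ f0 := h0.liftFromProjective_comp _ _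
  refine ⟨ChainComplex.mkHom _ _ f0 f1 hf1 fun n q =>
    ⟨(hK n).liftFromProjective (P.d (n + 2) (n + 1) ≫ q.2.1) ?_,
      (hK n).liftFromProjective_comp _ _⟩, ?_⟩
  · have := q.2.2
    simp [this]
  · simpa using hf0

/-- A chain map from a complex of projectives into an exact augmented complex is null-homotopic
if its augmentation vanishes. -/
theorem nonempty_homotopy_zero_of_exact {P K : ChainComplex C ℕ} [∀ n, Projective (P.X n)] {W : C}
    (ε : K.X 0 ⟶ W) (hε : K.d 1 0 ≫ ε = 0)
    (h0 : (ShortComplex.mk _ _ hε).Exact)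
    (hK : ∀ n, (ShortComplex.mk (K.d (n + 2) (n + 1)) (K.d (n + 1) n) (by simp)).Exact)
    (φ : P ⟶ K) (hφ : φ.f 0 ≫ ε = 0) : Nonempty (Homotopy φ 0) := by
  let s0 : P.X 0 ⟶ K.X 1 := h0.liftFromProjective (φ.f 0) hφ
  have hs0 : s0 ≫ K.d 1 0 = φ.f 0 := h0.liftFromProjective_comp _ _
  let s1 : P.X 1 ⟶ K.X 2 := (hK 0).liftFromProjective (φ.f 1 - P.d 1 0 ≫ s0) (by simp [hs0])
  have hs1 : s1 ≫ K.d 2 1 = φ.f 1 - P.d 1 0 ≫ s0 := (hK 0).liftFromProjective_comp _ _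
  refine ⟨Homotopy.mkInductive _ s0 hs0.symm s1 (by simp [hs1]) fun n q =>
    ⟨(hK (n + 1)).liftFromProjective (φ.f (n + 2) - P.d (n + 2) (n + 1) ≫ q.2.1) ?_, ?_⟩⟩
  · have := q.2.2
    simp [this]
  · have := (hK (n + 1)).liftFromProjective_comp
      (φ.f (n + 2) - P.d (n + 2) (n + 1) ≫ q.2.1) (by have := q.2.2; simp [this])
    simp only at this
    simp [this]

end Lifting

section Tensor

variable {C : Type*} [Category C] [MonoidalCategory C]

/-- The comparison of `X` with `X ⊗ B` along a unit `η`. -/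
@[simps]
def unitTensorNatTrans {B : C} (η : 𝟙_ C ⟶ B) : 𝟭 C ⟶ (tensoringRight C).obj B where
  app X := (ρ_ X).inv ≫ X ◁ η
  naturality X Y f := by
    change f ≫ (ρ_ Y).inv ≫ Y ◁ η = ((ρ_ X).inv ≫ X ◁ η) ≫ f ▷ B
    rw [Category.assoc, whisker_exchange, rightUnitor_inv_naturality_assoc]

/-- This is `hr` whiskered by `X`, followed by the triangle identity. Applied degreewise, it makes P
⊗ k a direct summand of (P ⊗ B) ⊗ k. -/
theorem comp_retraction {B k : C} (η : 𝟙_ C ⟶ B) (r : B ⊗ k ⟶ k) (hr : η ▷ k ≫ r = (λ_ k).hom)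
    (X : C) : ((ρ_ X).inv ≫ X ◁ η) ▷ k ≫ (α_ X B k).hom ≫ X ◁ r = 𝟙 _ := by
  have : X ◁ (η ▷ k) ≫ X ◁ r = X ◁ (λ_ k).hom := by rw [← whiskerLeft_comp, hr]
  simp [this]

/-- The natural retraction `(X ⊗ B) ⊗ k ⟶ X ⊗ k`. -/
@[simps]
def retractionNatTrans {B k : C} (r : B ⊗ k ⟶ k) :
    (tensoringRight C).obj B ⋙ (tensoringRight C).obj k ⟶ (tensoringRight C).obj k where
  app X := (α_ X B k).hom ≫ X ◁ r
  naturality X Y f := by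
    simp [whisker_exchange]

end Tensor

section Tor

variable {C : Type*} [Category C] [Abelian C]

/-- The augmentation of a projective resolution. -/
def augmentation {A : C} (P : ProjectiveResolution A) : P.complex.X 0 ⟶ A := P.π.f 0

theorem d_augmentation {A : C} (P : ProjectiveResolution A) :
    P.complex.d 1 0 ≫ augmentation P = 0 :=
  P.complex_d_comp_π_f_zero

theorem exact_augmentation {A : C} (P : ProjectiveResolution A) :
    (ShortComplex.mk _ _ (d_augmentation P)).Exact :=
  P.exact₀

instance epi_augmentation {A : C} (P : ProjectiveResolution A) : Epi (augmentation P) :=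
  inferInstanceAs (Epi (P.π.f 0))

variable [MonoidalCategory C] [MonoidalPreadditive C] [HasProjectiveResolutions C]

/-- If `P ⊗ B` resolves `A ⊗ B` for a projective resolution `P` of `A`, the canonical map
`A ⟶ A ⊗ B` factors through `f : A ⟶ A'`, and `k` is a `B`-module, then `f` induces
monomorphisms on `Tor(-, k)`. -/
theorem mono_tor'_map {A A' B k : C} (f : A ⟶ A') (η : 𝟙_ C ⟶ B) (r : B ⊗ k ⟶ k)
    (hr : η ▷ k ≫ r = (λ_ k).hom) (β : A' ⟶ A ⊗ B) (hβ : f ≫ β = (ρ_ A).inv ≫ A ◁ η)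
    (P : ProjectiveResolution A) (hepi : Epi (augmentation P ▷ B))
    (h0 : (ShortComplex.mk (P.complex.d 1 0 ▷ B) (augmentation P ▷ B)
      (by rw [← comp_whiskerRight, d_augmentation]; simp)).Exact)
    (hP : ∀ n, (ShortComplex.mk (P.complex.d (n + 2) (n + 1) ▷ B) (P.complex.d (n + 1) n ▷ B)
      (by rw [← comp_whiskerRight]; simp)).Exact) (q : ℕ) :
    Mono (((Tor' C q).map f).app k) := by
  let Q := projectiveResolution A'
  let g := ProjectiveResolution.lift f P Q
  have hg : g ≫ Q.π = P.π ≫ (ChainComplex.single₀ C).map f := ProjectiveResolution.lift_commutes ..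
  let T := (tensoringRight C).obj k
  let TB := (tensoringRight C).obj B
  let K := (TB.mapHomologicalComplex (ComplexShape.down ℕ)).obj P.complex
  let ε : K.X 0 ⟶ A ⊗ B := augmentation P ▷ B
  have hepi' : Epi ε := hepi
  -- `K` is P ⊗ B, exact over A ⊗ B, so `β` lifts to a chain map from the resolution of `A'`.
  obtain ⟨h, hh⟩ := exists_chainMap_of_exact (P := Q.complex) (K := K) ε _ h0 hP
    (augmentation Q ≫ β) (by rw [← Category.assoc, d_augmentation, zero_comp])
  let ι : P.complex ⟶ K :=
    (NatTrans.mapHomologicalComplex (unitTensorNatTrans η) (ComplexShape.down ℕ)).app P.complex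
  -- Both `g ≫ h` and `ι` cover the same map A ⟶ A ⊗ B, by `hβ`; hence they are homotopic.
  have hι : (g ≫ h - ι).f 0 ≫ ε = 0 := by
    have h1 : g.f 0 ≫ augmentation Q = augmentation P ≫ f :=
      ProjectiveResolution.lift_commutes_zero f P Q
    have h2 : ι.f 0 ≫ ε = augmentation P ≫ (ρ_ A).inv ≫ A ◁ η :=
      ((unitTensorNatTrans η).naturality (augmentation P)).symm
    rw [HomologicalComplex.sub_f_apply, Preadditive.sub_comp, h2, ← hβ,
      HomologicalComplex.comp_f, Category.assoc, hh, reassoc_of% h1, sub_self]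
  obtain ⟨H⟩ := nonempty_homotopy_zero_of_exact ε _ h0 hP _ hι
  let H' : Homotopy (g ≫ h) ι := Homotopy.equivSubZero.symm H
  let HT := T.mapHomotopy H'
  let ret : (T.mapHomologicalComplex _).obj K ⟶ (T.mapHomologicalComplex _).obj P.complex :=
    (NatTrans.mapHomologicalComplex (retractionNatTrans r) (ComplexShape.down ℕ)).app P.complex
  have hret : (T.mapHomologicalComplex _).map ι ≫ ret = 𝟙 _ := by
    ext n
    exact comp_retraction η r hr _
  -- The homotopy survives tensoring with `k`, so on homology `g ≫ h` may be replaced by `ι`, which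
  -- `ret` splits.
  have key : HomologicalComplex.homologyMap ((T.mapHomologicalComplex _).map g) q ≫
      HomologicalComplex.homologyMap ((T.mapHomologicalComplex _).map h ≫ ret) q = 𝟙 _ := by
    rw [← HomologicalComplex.homologyMap_comp, ← Category.assoc, ← Functor.map_comp,
      HomologicalComplex.homologyMap_comp, HT.homologyMap_eq, ← HomologicalComplex.homologyMap_comp,
      hret, HomologicalComplex.homologyMap_id]
  have hmono : Mono (HomologicalComplex.homologyMap ((T.mapHomologicalComplex _).map g) q) :=
    mono_of_mono_fac key
  change Mono ((T.leftDerived q).map f)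
  rw [Functor.leftDerived_map_eq T q f g hg]
  have : Mono ((T.mapHomologicalComplex _ ⋙ HomologicalComplex.homologyFunctor C _ q).map g) :=
    hmono
  infer_instance

end Tor

end CategoryTheory

/-! ### Depth over Noetherian local rings -/

section Depth

open IsLocalRing RingTheory.Sequence Pointwise

section

variable {R : Type*} [CommRing R] {M : Type*} [AddCommGroup M] [Module R M]

theorem mem_smul_top_iff {x : R} {u : M} : u ∈ x • (⊤ : Submodule R M) ↔ ∃ v, x • v = u := by
  simp [Submodule.mem_smul_pointwise_iff_exists]

variable [IsNoetherianRing R]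

theorem mem_associatedPrimes_iff {P : Ideal R} :
    P ∈ associatedPrimes R M ↔ P.IsPrime ∧ ∃ u : M, ∀ t, t ∈ P ↔ t • u = 0 := by
  rw [AssociatedPrimes.mem_iff, isAssociatedPrime_iff]
  refine and_congr_right fun _ => exists_congr fun u => ?_
  rw [SetLike.ext_iff]
  simp [Submodule.mem_colon_singleton]

theorem isSMulRegular_iff_forall_associatedPrimes {x : R} :
    IsSMulRegular M x ↔ ∀ P ∈ associatedPrimes R M, x ∉ P := by
  have := biUnion_associatedPrimes_eq_compl_regular R M
  rw [Set.ext_iff] at this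
  simpa [not_iff_comm] using (not_congr (this x)).symm

/-- An ideal killing a nonzero element of a finite module over a Noetherian ring
lies in an associated prime. -/
theorem exists_associatedPrime_of_smul_eq_zero {J : Ideal R} {u : M} (hu : u ≠ 0)
    (h : ∀ t ∈ J, t • u = 0) : ∃ P ∈ associatedPrimes R M, J ≤ P := by
  obtain ⟨P, hP, hle⟩ := exists_le_isAssociatedPrime_of_isNoetherianRing R u hu
  exact ⟨P, hP, fun t ht => hle (by simpa [Submodule.mem_colon_singleton] using h t ht)⟩

end

variable {R : Type*} [CommRing R] [IsLocalRing R]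

/-- `M` has a regular sequence of length `r` consisting of elements of the maximal ideal. -/
def HasRegularSequence (R : Type*) [CommRing R] [IsLocalRing R] (M : Type*) [AddCommGroup M]
    [Module R M] (r : ℕ) : Prop :=
  ∃ rs : List R, rs.length = r ∧ (∀ x ∈ rs, x ∈ maximalIdeal R) ∧ IsRegular M rs

section

variable {M : Type*} [AddCommGroup M] [Module R M] {r : ℕ}

theorem HasRegularSequence.nontrivial (h : HasRegularSequence R M r) : Nontrivial M := by
  obtain ⟨rs, -, -, h⟩ := h
  exact h.nontrivial

theorem hasRegularSequence_zero [Nontrivial M] : HasRegularSequence R M 0 :=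
  ⟨[], rfl, by simp, IsRegular.nil R M⟩

theorem hasRegularSequence_succ_iff :
    HasRegularSequence R M (r + 1) ↔ ∃ x ∈ maximalIdeal R, IsSMulRegular M x ∧
      HasRegularSequence R (QuotSMulTop x M) r := by
  constructor
  · rintro ⟨rs, hl, hm, hr⟩
    cases rs with
    | nil => simp at hl
    | cons x rs =>
      rw [isRegular_cons_iff] at hr
      exact ⟨x, hm x (by simp), hr.1, rs, by simpa using hl,
        fun y hy => hm y (by simp [hy]), hr.2⟩
  · rintro ⟨x, hx, hreg, rs, hl, hm, hr⟩
    exact ⟨x :: rs, by simp [hl], List.forall_mem_cons.2 ⟨hx, hm⟩, (isRegular_cons_iff M x rs).2 ⟨hreg, hr⟩⟩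

theorem HasRegularSequence.congr {M' : Type*} [AddCommGroup M'] [Module R M']
    (e : M ≃ₗ[R] M') (h : HasRegularSequence R M r) : HasRegularSequence R M' r := by
  obtain ⟨rs, hl, hm, hr⟩ := h
  exact ⟨rs, hl, hm, (e.isRegular_congr rs).1 hr⟩

theorem HasRegularSequence.mono {s : ℕ} (h : HasRegularSequence R M r) (hs : s ≤ r) :
    HasRegularSequence R M s := by
  induction s generalizing M r with
  | zero =>
    have := h.nontrivial
    exact hasRegularSequence_zero
  | succ s ih =>
    obtain ⟨r, rfl⟩ : ∃ r', r = r' + 1 := ⟨r - 1, by omega⟩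
    obtain ⟨x, hx, hreg, h'⟩ := hasRegularSequence_succ_iff.1 h
    exact hasRegularSequence_succ_iff.2 ⟨x, hx, hreg, ih h' (by omega)⟩

end

/-- Prime avoidance. -/
theorem exists_mem_forall_notMem {A : Type*} [CommRing A] {J : Ideal A} {T : Set (Ideal A)}
    (hT : T.Finite) (hp : ∀ P ∈ T, P.IsPrime) (hJ : ∀ P ∈ T, ¬ J ≤ P) :
    ∃ a ∈ J, ∀ P ∈ T, a ∉ P := by
  by_contra! h
  have hsub : (J : Set A) ⊆ ⋃ P ∈ T, (P : Set A) := fun a ha => by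
    obtain ⟨P, hP, haP⟩ := h a ha
    exact Set.mem_biUnion hP haP
  obtain ⟨P, hP, hle⟩ := (Ideal.subset_union_prime_finite hT (f := id) ⊥ ⊥
    (fun P hP _ _ => hp P hP)).1 hsub
  exact hJ P hP hle

theorem not_maximalIdeal_le {T : Set (Ideal R)} (hp : ∀ P ∈ T, P.IsPrime)
    (h : maximalIdeal R ∉ T) : ∀ P ∈ T, ¬ maximalIdeal R ≤ P := by
  intro P hP hle
  have := (maximalIdeal.isMaximal R).eq_of_le (hp P hP).ne_top hle
  exact h (this ▸ hP)

section

variable [IsNoetherianRing R] {M : Type*} [AddCommGroup M] [Module R M]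

theorem maximalIdeal_notMem_associatedPrimes {x : R} (hx : x ∈ maximalIdeal R)
    (h : IsSMulRegular M x) : maximalIdeal R ∉ associatedPrimes R M := fun hm =>
  isSMulRegular_iff_forall_associatedPrimes.1 h _ hm hx

theorem maximalIdeal_mem_associatedPrimes_of_smul_eq_zero {u : M} (hu : u ≠ 0)
    (h : ∀ t ∈ maximalIdeal R, t • u = 0) : maximalIdeal R ∈ associatedPrimes R M := by
  obtain ⟨P, hP, hle⟩ := exists_associatedPrime_of_smul_eq_zero hu h
  rwa [(maximalIdeal.isMaximal R).eq_of_le hP.isPrime.ne_top hle]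

/-- Whether the maximal ideal is associated to `M / x M` does not depend on the `M`-regular
element `x`. -/
theorem maximalIdeal_mem_associatedPrimes_quotSMulTop {x a : R}
    (hx : IsSMulRegular M x) (ha : IsSMulRegular M a) (hxm : x ∈ maximalIdeal R)
    (h : maximalIdeal R ∈ associatedPrimes R (QuotSMulTop a M)) :
    maximalIdeal R ∈ associatedPrimes R (QuotSMulTop x M) := by
  obtain ⟨-, u, hu⟩ := mem_associatedPrimes_iff.1 h
  obtain ⟨u, rfl⟩ := Submodule.Quotient.mk_surjective _ u
  have hu' : ∀ t ∈ maximalIdeal R, ∃ v, a • v = t • u := fun t ht => by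
    have := (hu t).1 ht
    rwa [← Submodule.Quotient.mk_smul, Submodule.Quotient.mk_eq_zero, mem_smul_top_iff] at this
  have hu1 : ¬ ∃ v, a • v = u := by
    rw [← mem_smul_top_iff, ← Submodule.Quotient.mk_eq_zero]
    intro h0
    exact (Ideal.ne_top_iff_one _).1 (maximalIdeal.isMaximal R).ne_top ((hu 1).2 (by simpa using h0))
  -- The socles of M/aM and M/xM correspond through the relation a v = x u. If v = x w, cancelling x
  -- gives u = a w.
  obtain ⟨v, hv⟩ := hu' x hxm
  refine maximalIdeal_mem_associatedPrimes_of_smul_eq_zero (u := Submodule.Quotient.mk v) ?_ ?_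
  · rw [Ne, Submodule.Quotient.mk_eq_zero, mem_smul_top_iff]
    rintro ⟨w, rfl⟩
    exact hu1 ⟨w, hx (by simp only [← hv]; exact smul_comm x a w)⟩
  · intro t ht
    rw [← Submodule.Quotient.mk_smul, Submodule.Quotient.mk_eq_zero, mem_smul_top_iff]
    obtain ⟨w, hw⟩ := hu' t ht
    refine ⟨w, ha ?_⟩
    change a • x • w = a • t • v
    rw [smul_comm a x, hw, smul_comm a t, hv, smul_comm]

variable [Module.Finite R M]

/-- Regular sequences on a finite module over a Noetherian local ring may be permuted. The remaining
sequence of length `r` is carried along unchanged. -/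
theorem HasRegularSequence.swap {x y : R} (hx : IsSMulRegular M x) (hy : IsSMulRegular (QuotSMulTop x M) y)
    {r : ℕ} (h : HasRegularSequence R (QuotSMulTop y (QuotSMulTop x M)) r) :
    IsSMulRegular M y ∧ IsSMulRegular (QuotSMulTop y M) x ∧
      HasRegularSequence R (QuotSMulTop x (QuotSMulTop y M)) r := by
  obtain ⟨rs, hl, hm, hr⟩ := h
  have h1 : IsRegular M (x :: y :: rs) :=
    (isRegular_cons_iff M x _).2 ⟨hx, (isRegular_cons_iff _ y _).2 ⟨hy, hr⟩⟩
  have h2 := IsLocalRing.isRegular_of_perm h1 (List.Perm.swap y x rs)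
  obtain ⟨h3, h4⟩ := (isRegular_cons_iff M y _).1 h2
  obtain ⟨h5, h6⟩ := (isRegular_cons_iff _ x _).1 h4
  exact ⟨h3, h5, rs, hl, hm, h6⟩

/-- Dividing by a regular element of the maximal ideal lowers the depth by at most one. -/
theorem HasRegularSequence.quotSMulTop {r : ℕ} (h : HasRegularSequence R M (r + 1)) {a : R}
    (ham : a ∈ maximalIdeal R) (ha : IsSMulRegular M a) :
    HasRegularSequence R (QuotSMulTop a M) r := by
  induction r generalizing M a with
  | zero =>
    have := h.nontrivial
    have := nontrivial_quotSMulTop_of_mem_maximalIdeal M ham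
    exact hasRegularSequence_zero
  | succ r ih =>
    obtain ⟨x, hxm, hx, h'⟩ := hasRegularSequence_succ_iff.1 h
    obtain ⟨z, hzm, hz, -⟩ := hasRegularSequence_succ_iff.1 h'
    have h1 := maximalIdeal_notMem_associatedPrimes hzm hz
    have h2 : maximalIdeal R ∉ associatedPrimes R (QuotSMulTop a M) := fun h2 =>
      h1 (maximalIdeal_mem_associatedPrimes_quotSMulTop hx ha hxm h2)
    have hp : ∀ P ∈ associatedPrimes R (QuotSMulTop x M) ∪ associatedPrimes R (QuotSMulTop a M),
        P.IsPrime := by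
      rintro P (hP | hP) <;> exact hP.isPrime
    -- The element `y` is chosen regular on both M/xM and M/aM, so that it can be exchanged with `x`
    -- and with `a`. Induction is used twice: on M/xM with `y`, which shows that M/yM has depth at
    -- least r + 1, and then on M/yM with `a`.
    obtain ⟨y, hym, hy⟩ := exists_mem_forall_notMem (J := maximalIdeal R)
      ((associatedPrimes.finite R (QuotSMulTop x M)).union
        (associatedPrimes.finite R (QuotSMulTop a M))) hp
        (not_maximalIdeal_le hp (by simp [h1, h2]))
    have hyx : IsSMulRegular (QuotSMulTop x M) y :=
      isSMulRegular_iff_forall_associatedPrimes.2 fun P hP => hy P (Or.inl hP)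
    have hya : IsSMulRegular (QuotSMulTop a M) y :=
      isSMulRegular_iff_forall_associatedPrimes.2 fun P hP => hy P (Or.inr hP)
    obtain ⟨hyM, hxy, h3⟩ := HasRegularSequence.swap hx hyx (ih h' hym hyx)
    have h4 : HasRegularSequence R (QuotSMulTop y M) (r + 1) :=
      hasRegularSequence_succ_iff.2 ⟨x, hxm, hxy, h3⟩
    have : Nontrivial M := h.nontrivial
    have := nontrivial_quotSMulTop_of_mem_maximalIdeal M ham
    have := nontrivial_quotSMulTop_of_mem_maximalIdeal (QuotSMulTop a M) hym
    obtain ⟨-, hay, -⟩ := HasRegularSequence.swap ha hya hasRegularSequence_zero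
    obtain ⟨-, -, h5⟩ := HasRegularSequence.swap hyM hay (ih h4 ham hay)
    exact hasRegularSequence_succ_iff.2 ⟨y, hym, hya, h5⟩

/-- The dimension of `R / P` for an associated prime `P` of `M` is at least the depth of `M`. -/
theorem HasRegularSequence.le_coheight {r : ℕ} (h : HasRegularSequence R M r)
    {P : PrimeSpectrum R} (hP : P.asIdeal ∈ associatedPrimes R M) :
    (r : ℕ∞) ≤ Order.coheight P := by
  induction r generalizing M P with
  | zero => simp
  | succ r ih =>
    obtain ⟨x, hxm, hx, h'⟩ := hasRegularSequence_succ_iff.1 h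
    obtain ⟨-, u, hu⟩ := mem_associatedPrimes_iff.1 hP
    have hu0 : u ≠ 0 := by
      rintro rfl
      exact (Ideal.ne_top_iff_one _).1 P.2.ne_top ((hu 1).2 (by simp))
    -- `T` is the submodule killed by `P`. If it were contained in xM, regularity of `x` would give
    -- T = xT, and Nakayama would force T = 0. An element of `T` outside xM then yields an
    -- associated prime of M/xM containing P + (x).
    let T : Submodule R M :=
      { carrier := {v | ∀ t ∈ P.asIdeal, t • v = 0}
        add_mem' := fun ha hb t ht => by rw [smul_add, ha t ht, hb t ht, add_zero]
        zero_mem' := fun t _ => smul_zero t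
        smul_mem' := fun c v hv t ht => by rw [smul_comm, hv t ht, smul_zero] }
    have hT : ¬ T ≤ x • (⊤ : Submodule R M) := by
      intro hle
      have hTx : T ≤ maximalIdeal R • T := by
        intro v hv
        obtain ⟨w, rfl⟩ := mem_smul_top_iff.1 (hle hv)
        refine Submodule.smul_mem_smul hxm fun t ht => hx ?_
        change x • t • w = x • (0 : M)
        rw [smul_comm, hv t ht, smul_zero]
      have hbot : T = ⊥ := Submodule.eq_bot_of_le_smul_of_le_jacobson_bot _ _
        (IsNoetherian.noetherian T) hTx (by rw [IsLocalRing.jacobson_eq_maximalIdeal _ bot_ne_top])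
      have : u ∈ T := fun t ht => (hu t).1 ht
      rw [hbot] at this
      exact hu0 (by simpa using this)
    obtain ⟨v, hvT, hvx⟩ := Set.not_subset.1 hT
    have hv0 : (Submodule.Quotient.mk v : QuotSMulTop x M) ≠ 0 := by
      rwa [Ne, Submodule.Quotient.mk_eq_zero]
    obtain ⟨P', hP', hle⟩ := exists_associatedPrime_of_smul_eq_zero (J := P.asIdeal ⊔ Ideal.span {x})
      hv0 (by
        intro t ht
        obtain ⟨p, hp, q, hq, rfl⟩ := Submodule.mem_sup.1 ht
        obtain ⟨c, rfl⟩ := Ideal.mem_span_singleton'.1 hq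
        rw [add_smul, ← Submodule.Quotient.mk_smul, hvT p hp, ← Submodule.Quotient.mk_smul,
          Submodule.Quotient.mk_zero, zero_add, Submodule.Quotient.mk_eq_zero, mem_smul_top_iff]
        exact ⟨c • v, by rw [mul_smul, smul_comm]⟩)
    let P'' : PrimeSpectrum R := ⟨P', hP'.isPrime⟩
    have hlt : P < P'' := by
      refine lt_of_le_of_ne (le_sup_left.trans hle) fun heq => ?_
      have hxP : x ∈ P.asIdeal := by
        rw [heq]
        exact hle (Ideal.mem_sup_right (Ideal.mem_span_singleton_self x))
      exact isSMulRegular_iff_forall_associatedPrimes.1 hx _ hP hxP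
    have h1 : (r : ℕ∞) ≤ Order.coheight P'' := ih h' hP'
    calc ((r + 1 : ℕ) : ℕ∞) = r + 1 := by simp
      _ ≤ Order.coheight P'' + 1 := by gcongr
      _ ≤ Order.coheight P := Order.coheight_add_one_le hlt

/-- If `M` has depth `p` and every prime in the support of `M` containing `J` has coheight less
than `p`, then `J` contains an `M`-regular element. -/
theorem HasRegularSequence.exists_isSMulRegular {p : ℕ} (h : HasRegularSequence R M p)
    (J : Ideal R) (hJ : ∀ P : PrimeSpectrum R, Module.annihilator R M ≤ P.asIdeal →
      J ≤ P.asIdeal → Order.coheight P < p) : ∃ a ∈ J, IsSMulRegular M a := by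
  obtain ⟨a, haJ, ha⟩ := exists_mem_forall_notMem (J := J) (associatedPrimes.finite R M)
    (fun P hP => hP.isPrime) (fun P hP hle => by
      have h1 := hJ ⟨P, hP.isPrime⟩ (by
        have := IsAssociatedPrime.annihilator_le hP
        rwa [Submodule.annihilator_top] at this) hle
      exact absurd (h.le_coheight (P := ⟨P, hP.isPrime⟩) hP) (not_le.2 h1))
  exact ⟨a, haJ, isSMulRegular_iff_forall_associatedPrimes.2 ha⟩

/-- When the coheight of `P` is below the depth, `P` contains an M-regular element `a`, and `P`
still supports M/aM. The inductive chain for M/aM starts at a prime containing `a`; a minimal prime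
over the annihilator of M lies strictly below it, because a regular element avoids such primes. -/
theorem HasRegularSequence.exists_ltSeries {p c : ℕ} (h : HasRegularSequence R M p)
    {P : PrimeSpectrum R} (hP : P ∈ Module.support R M) (hc : Order.coheight P + c ≤ p) :
    ∃ l : LTSeries (PrimeSpectrum R), l.length = c ∧ l.last = P ∧
      l.head ∈ Module.support R M := by
  induction c generalizing M p with
  | zero => exact ⟨RelSeries.singleton _ P, rfl, rfl, hP⟩
  | succ c ih =>
    have hlt : Order.coheight P < p := by
      have hfin : Order.coheight P ≠ ⊤ := by
        rintro h0
        rw [h0] at hc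
        simp at hc
      lift Order.coheight P to ℕ using hfin with m
      norm_cast at hc ⊢
      omega
    obtain ⟨a, haP, ha⟩ := h.exists_isSMulRegular P.asIdeal fun Q _ hQ =>
      (Order.coheight_anti (show P ≤ Q from hQ)).trans_lt hlt
    have ham : a ∈ maximalIdeal R := le_maximalIdeal P.2.ne_top haP
    obtain ⟨p, rfl⟩ : ∃ p', p = p' + 1 := ⟨p - 1, by
      have : p ≠ 0 := by rintro rfl; simp at hlt
      omega⟩
    have hPa : P ∈ Module.support R (QuotSMulTop a M) := by
      rw [Module.support_quotSMulTop]
      exact ⟨hP, by simpa using haP⟩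
    obtain ⟨l, hl, hlast, hhead⟩ := ih (h.quotSMulTop ham ha) hPa (by
      have : (Order.coheight P + c) + 1 ≤ (p : ℕ∞) + 1 := by
        push_cast at hc
        rwa [add_assoc]
      exact (ENat.add_le_add_iff_right (by simp)).1 this)
    rw [Module.support_quotSMulTop] at hhead
    obtain ⟨Q, hQ, hQle⟩ := Ideal.exists_minimalPrimes_le
      (Module.mem_support_iff_of_finite.1 hhead.1)
    let Q' : PrimeSpectrum R := ⟨Q, hQ.1.1⟩
    have hlt' : Q' < l.head := by
      refine lt_of_le_of_ne hQle fun heq => ha.notMem_of_mem_minimalPrimes hQ ?_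
      have : a ∈ l.head.asIdeal := by simpa using hhead.2
      rw [← heq] at this
      exact this
    exact ⟨l.cons Q' hlt', by simp [hl], (RelSeries.last_cons ..).trans hlast,
      Module.mem_support_iff_of_finite.2 hQ.1.2⟩

/-- The case M = R of the preceding chain construction: there is a chain of length n minus the
coheight ending at `P`. At the vertex of the cone this is the lower half of the dimension formula.
-/
theorem HasRegularSequence.le_height_add_coheight {n : ℕ} (h : HasRegularSequence R R n)
    (P : PrimeSpectrum R) : (n : ℕ∞) ≤ Order.height P + Order.coheight P := by
  by_cases hfin : Order.coheight P = ⊤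
  · simp [hfin]
  by_cases hle : (n : ℕ∞) ≤ Order.coheight P
  · exact hle.trans le_add_self
  obtain ⟨m, hm⟩ := ENat.ne_top_iff_exists.1 hfin
  rw [← hm] at hle ⊢
  norm_cast at hle
  obtain ⟨l, hl, hlast, -⟩ := h.exists_ltSeries (c := n - m) (P := P)
    (by rw [Module.mem_support_iff_of_finite, Module.annihilator_eq_bot.2 inferInstance]
        exact bot_le) (by rw [← hm]; norm_cast; omega)
  have : ((n - m : ℕ) : ℕ∞) ≤ Order.height P := by
    rw [← hl, ← hlast]
    exact Order.length_le_height_last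
  calc (n : ℕ∞) = ((n - m : ℕ) : ℕ∞) + m := by norm_cast; omega
    _ ≤ _ := by gcongr

end

end Depth

/-! ### Vanishing of Ext into character modules, as a substitute for Tor -/

section ExtVanishing

open IsLocalRing RingTheory.Sequence Pointwise CategoryTheory.Abelian

universe u

section Scalars

variable {R : Type u} [CommRing R] {X Y : ModuleCat.{u} R}

theorem mk₀_smul_id_comp (x : R) {i : ℕ} (e : Ext X Y i) :
    (Ext.mk₀ (x • 𝟙 X)).comp e (zero_add i) = x • e := by
  simp [Ext.mk₀_smul]

theorem comp_mk₀_smul_id (x : R) {i : ℕ} (e : Ext X Y i) :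
    e.comp (Ext.mk₀ (x • 𝟙 Y)) (add_zero i) = x • e := by
  simp [Ext.mk₀_smul]

theorem smul_ext_eq_zero_of_left {x : R} (h : ∀ u : X, x • u = 0) {i : ℕ} (e : Ext X Y i) :
    x • e = 0 := by
  have h1 : x • 𝟙 X = 0 := by
    ext u
    exact h u
  rw [← mk₀_smul_id_comp, h1, Ext.mk₀_zero, Ext.zero_comp]

theorem smul_ext_eq_zero_of_right {x : R} (h : ∀ u : Y, x • u = 0) {i : ℕ} (e : Ext X Y i) :
    x • e = 0 := by
  have h1 : x • 𝟙 Y = 0 := by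
    ext u
    exact h u
  rw [← comp_mk₀_smul_id, h1, Ext.mk₀_zero, Ext.comp_zero]

end Scalars

section Dual

variable {R : Type u} [CommRing R] {A B C : Type u} [AddCommGroup A] [AddCommGroup B]
  [AddCommGroup C] [Module R A] [Module R B] [Module R C]

/-- The character module as an object of the category of modules. -/
abbrev dualModule (R : Type u) [CommRing R] (A : Type u) [AddCommGroup A] [Module R A] :
    ModuleCat.{u} R :=
  ModuleCat.of R (CharacterModule A)

/-- The dual of a pair of composable linear maps with composite zero. -/
def dualShortComplex (f : A →ₗ[R] B) (g : B →ₗ[R] C) (h : g ∘ₗ f = 0) :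
    ShortComplex (ModuleCat.{u} R) :=
  ShortComplex.mk (X₁ := dualModule R C) (X₂ := dualModule R B) (X₃ := dualModule R A)
    (ModuleCat.ofHom (CharacterModule.dual g)) (ModuleCat.ofHom (CharacterModule.dual f)) (by
      rw [← ModuleCat.ofHom_comp, ← CharacterModule.dual_comp, h, CharacterModule.dual_zero]
      rfl)

theorem dualShortComplex_shortExact {f : A →ₗ[R] B} {g : B →ₗ[R] C} (hf : Function.Injective f)
    (hg : Function.Surjective g) (h : Function.Exact f g) :
    (dualShortComplex f g h.linearMap_comp_eq_zero).ShortExact := by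
  have hmono : Mono (dualShortComplex f g h.linearMap_comp_eq_zero).f :=
    (ModuleCat.mono_iff_injective _).2 (CharacterModule.dual_injective_of_surjective g hg)
  have hepi : Epi (dualShortComplex f g h.linearMap_comp_eq_zero).g :=
    (ModuleCat.epi_iff_surjective _).2 (CharacterModule.dual_surjective_of_injective f hf)
  refine ⟨(ShortComplex.moduleCat_exact_iff _).2 fun (c : CharacterModule B) hc => ?_⟩
  have hc' : ∀ a, c (f a) = 0 := fun a => DFunLike.congr_fun (F := CharacterModule A) hc a
  refine ⟨AddMonoidHom.liftOfSurjective g.toAddMonoidHom hg ⟨c, fun b hb => ?_⟩, ?_⟩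
  · obtain ⟨a, rfl⟩ := (h b).1 hb
    exact hc' a
  · refine CharacterModule.ext (A := B) fun b =>
      AddMonoidHom.liftOfRightInverse_comp_apply g.toAddMonoidHom _
      (Function.rightInverse_surjInv hg) _ b

theorem injective_dualModule {B : Type u} [AddCommGroup B] [Module R B] [Module.Flat R B] :
    Injective (dualModule R B) := by
  have : Module.Injective R (CharacterModule B) := Module.Flat.iff_characterModule_injective.1 ‹_›
  exact Module.injective_object_of_injective_module R _

end Dual

section Local

variable {R : Type u} [CommRing R] [IsLocalRing R]

/-- The residue field of a local ring as an object of the category of modules. -/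
abbrev residueModule (R : Type u) [CommRing R] [IsLocalRing R] : ModuleCat.{u} R :=
  ModuleCat.of R (R ⧸ maximalIdeal R)

theorem smul_residueModule_eq_zero {x : R} (hx : x ∈ maximalIdeal R) (u : residueModule R) :
    x • u = 0 := by
  obtain ⟨v, rfl⟩ := Ideal.Quotient.mk_surjective u
  change Ideal.Quotient.mk _ (x * v) = 0
  exact Ideal.Quotient.eq_zero_iff_mem.2 (Ideal.mul_mem_right _ _ hx)

/-- The depth of `B` bounds the degrees of the extensions of the residue field by the dual
of `B`. -/
theorem HasRegularSequence.ext_residueModule_dualModule_eq_zero {n q : ℕ}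
    (hn : ∀ (W : ModuleCat.{u} R) (i : ℕ), n < i → ∀ e : Ext (residueModule R) W i, e = 0)
    {B : Type u} [AddCommGroup B] [Module R B] (h : HasRegularSequence R B q) {i : ℕ}
    (hi : n < i + q) (e : Ext (residueModule R) (dualModule R B) i) : e = 0 := by
  induction q generalizing B i with
  | zero => exact hn _ i hi e
  | succ q ih =>
    obtain ⟨x, hxm, hx, h'⟩ := hasRegularSequence_succ_iff.1 h
    have hS := dualShortComplex_shortExact (f := LinearMap.lsmul R B x)
      (g := (x • (⊤ : Submodule R B)).mkQ) hx (Submodule.mkQ_surjective _)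
      (LinearMap.exact_lsmul_mkQ_smul_top B x)
    -- The dual sequence is 0 → (B/xB)* → B* → B* → 0, with second map multiplication by `x`. The
    -- obstruction in degree i + 1 vanishes by induction, so `e` is x times a class, and `x` kills
    -- the residue field.
    obtain ⟨e', he'⟩ : ∃ e' : Ext (residueModule R) (dualModule R B) i,
        e'.comp (Ext.mk₀ (x • 𝟙 (dualModule R B))) (add_zero i) = e :=
      Ext.covariant_sequence_exact₃ (residueModule R) hS e rfl (ih h' (by omega) _)
    rw [← he', comp_mk₀_smul_id]
    exact smul_ext_eq_zero_of_left (smul_residueModule_eq_zero hxm) e'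

variable [IsNoetherianRing R]

/-- Ext¹ of the residue field into B* is the obstruction to extending maps 𝔪 → B* to R. Dually, its
vanishing says that 𝔪 ⊗ B → R ⊗ B is injective, which is the local criterion for freeness. -/
theorem free_of_ext_one_residueModule_dualModule_eq_zero {B : Type u} [AddCommGroup B] [Module R B]
    [Module.Finite R B] (h : ∀ e : Ext (residueModule R) (dualModule R B) 1, e = 0) :
    Module.Free R B := by
  have : Module.FinitePresentation R B := Module.finitePresentation_of_finite R B
  refine Module.free_of_maximalIdeal_rTensor_injective
    (rTensor_injective_iff_lcomp_surjective.2 fun φ => ?_)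
  let T : ShortComplex (ModuleCat.{u} R) := ModuleCat.shortComplexOfCompEqZero
    (maximalIdeal R).subtype (maximalIdeal R).mkQ (LinearMap.exact_subtype_mkQ (maximalIdeal R)).linearMap_comp_eq_zero
  have hT : T.ShortExact :=
    { exact := ModuleCat.shortComplex_exact _ (LinearMap.exact_subtype_mkQ (maximalIdeal R))
      mono_f := (ModuleCat.mono_iff_injective _).2 Subtype.val_injective
      epi_g := (ModuleCat.epi_iff_surjective _).2 (Submodule.mkQ_surjective _) }
  obtain ⟨x, hx⟩ := Ext.contravariant_sequence_exact₁ hT (dualModule R B)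
    (Ext.mk₀ (ModuleCat.ofHom φ : T.X₁ ⟶ dualModule R B)) (add_zero 1) (h _)
  obtain ⟨ψ, rfl⟩ := Ext.homEquiv₀.symm.surjective x
  refine ⟨ψ.hom, ?_⟩
  have h1 : T.f ≫ ψ = ModuleCat.ofHom φ := by
    apply Ext.homEquiv₀.symm.injective
    change Ext.mk₀ _ = Ext.mk₀ _
    rw [← hx, ← Ext.mk₀_comp_mk₀]
    rfl
  exact congrArg ModuleCat.Hom.hom h1

/-- Over a Noetherian local ring, the injective dimension of the dual of a finite module
is tested by the residue field. -/
theorem ext_dualModule_eq_zero {e : ℕ} {B : Type u} [AddCommGroup B] [Module R B]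
    [Module.Finite R B] (h : ∀ x : Ext (residueModule R) (dualModule R B) (e + 1), x = 0)
    (W : ModuleCat.{u} R) {i : ℕ} (hi : e < i) (x : Ext W (dualModule R B) i) : x = 0 := by
  induction e generalizing B i with
  | zero =>
    have := free_of_ext_one_residueModule_dualModule_eq_zero h
    have := injective_dualModule (R := R) (B := B)
    obtain ⟨i, rfl⟩ : ∃ j, i = j + 1 := ⟨i - 1, by omega⟩
    exact Ext.eq_zero_of_injective x
  | succ e ih =>
    -- Dimension shifting along the dual of a finite free cover of `B`: the dual of the free module
    -- is injective, so the dual of the kernel carries the Ext groups one degree lower.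
    obtain ⟨a, g, hg⟩ := Module.Finite.exists_fin' R B
    have hS := dualShortComplex_shortExact (f := (LinearMap.ker g).subtype) (g := g)
      Subtype.val_injective hg (LinearMap.exact_subtype_ker_map g)
    have hinj : Injective (dualModule R (Fin a → R)) := injective_dualModule
    obtain ⟨i, rfl⟩ : ∃ j, i = j + 1 := ⟨i - 1, by omega⟩
    obtain ⟨y, hy⟩ := Ext.covariant_sequence_exact₁ W hS x
      (Ext.eq_zero_of_injective (I := dualModule R (Fin a → R)) _) rfl
    have hy0 : y = 0 := by
      refine ih (B := LinearMap.ker g) (fun z => ?_) (by omega) y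
      obtain ⟨w, hw⟩ := Ext.covariant_sequence_exact₃ (residueModule R) hS z rfl (h _)
      have hw0 : w = 0 := Ext.eq_zero_of_injective (I := dualModule R (Fin a → R)) w
      rw [← hw, hw0]
      exact Ext.zero_comp ..
    rw [← hy, hy0]
    exact Ext.zero_comp ..

/-- Associated primes of M have coheight at least `p`, while primes supporting both modules have
coheight below `p` as long as c > 0; so some `a` killing `B` is M-regular. By induction Ext in
degree i + 1 of M/aM vanishes, hence `a` acts surjectively on Ext in degree i of M. It also acts as
zero there, because it kills B*. -/
theorem HasRegularSequence.ext_dualModule_eq_zero {e p c : ℕ} {M B : Type u} [AddCommGroup M]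
    [Module R M] [Module.Finite R M] [AddCommGroup B] [Module R B] [Nontrivial B]
    (hM : HasRegularSequence R M p)
    (he : ∀ (W : ModuleCat.{u} R) (i : ℕ), e < i → ∀ x : Ext W (dualModule R B) i, x = 0)
    (hc : ∀ P : PrimeSpectrum R, Module.annihilator R M ≤ P.asIdeal →
      Module.annihilator R B ≤ P.asIdeal → Order.coheight P + c ≤ p)
    {i : ℕ} (hi : 1 ≤ i) (hic : e < i + c) (x : Ext (ModuleCat.of R M) (dualModule R B) i) :
    x = 0 := by
  induction c generalizing M p i with
  | zero => exact he _ i hic x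
  | succ c ih =>
    have hnt := hM.nontrivial
    have hlt : ∀ P : PrimeSpectrum R, Module.annihilator R M ≤ P.asIdeal →
        Module.annihilator R B ≤ P.asIdeal → Order.coheight P < p := fun P h1 h2 =>
      lt_of_lt_of_le (by
        have hfin : Order.coheight P ≠ ⊤ := fun h0 => by simpa [h0] using hc P h1 h2
        exact (ENat.lt_add_one_iff hfin).2 le_rfl) ((by push_cast; gcongr; exact le_add_self :
          Order.coheight P + 1 ≤ Order.coheight P + (c + 1 : ℕ)).trans (hc P h1 h2))
    have hann : ∀ (A : Type u) [AddCommGroup A] [Module R A] [Nontrivial A],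
        Module.annihilator R A ≤ maximalIdeal R := fun A _ _ _ =>
      le_maximalIdeal fun h0 => not_subsingleton A (Module.annihilator_eq_top_iff.1 h0)
    have hp : p ≠ 0 := by
      rintro rfl
      simpa using hlt ⟨maximalIdeal R, inferInstance⟩ (hann M) (hann B)
    obtain ⟨p, rfl⟩ : ∃ p', p = p' + 1 := ⟨p - 1, by omega⟩
    obtain ⟨a, haB, ha⟩ := hM.exists_isSMulRegular (Module.annihilator R B) hlt
    have hMa := hM.quotSMulTop (hann B haB) ha
    have hS := IsSMulRegular.smulShortComplex_shortExact (M := ModuleCat.of R M) ha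
    obtain ⟨y, hy⟩ : ∃ y : Ext (ModuleCat.of R M) (dualModule R B) i,
        (Ext.mk₀ (a • 𝟙 (ModuleCat.of R M))).comp y (zero_add i) = x :=
      Ext.contravariant_sequence_exact₁ hS (dualModule R B) x (add_comm 1 i)
      (ih hMa (fun P h1 h2 => by
        have := hc P (le_trans (LinearMap.annihilator_le_of_surjective _
          (Submodule.mkQ_surjective (a • (⊤ : Submodule R M)))) h1) h2
        push_cast at this
        rw [← add_assoc] at this
        exact (ENat.add_le_add_iff_right (by simp)).1 this) (by omega) (by omega) _)
    rw [← hy, mk₀_smul_id_comp]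
    refine smul_ext_eq_zero_of_right (fun c => CharacterModule.ext (A := B) fun b => ?_) y
    change (c : CharacterModule B) (a • b) = 0
    rw [Module.mem_annihilator.1 haB b, map_zero]

/-- If `M` and `B` intersect properly and `M ⊗ B` is not of finite length, some element of the
maximal ideal acts surjectively on the homomorphisms into the dual of `B`. -/
theorem HasRegularSequence.exists_smul_hom_surjective {e p c : ℕ} {M B : Type u} [AddCommGroup M]
    [Module R M] [Module.Finite R M] [AddCommGroup B] [Module R B] [Nontrivial B]
    (hM : HasRegularSequence R M p)
    (he : ∀ (W : ModuleCat.{u} R) (i : ℕ), e < i → ∀ x : Ext W (dualModule R B) i, x = 0)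
    (hc : ∀ P : PrimeSpectrum R, Module.annihilator R M ≤ P.asIdeal →
      Module.annihilator R B ≤ P.asIdeal → Order.coheight P + c ≤ p)
    (hcp : c < p) (hec : e ≤ c) :
    ∃ y ∈ maximalIdeal R, ∀ φ : M →ₗ[R] CharacterModule B,
      ∃ ψ : M →ₗ[R] CharacterModule B, y • ψ = φ := by
  obtain ⟨p, rfl⟩ : ∃ p', p = p' + 1 := ⟨p - 1, by omega⟩
  have hm : maximalIdeal R ∉ associatedPrimes R M := by
    obtain ⟨x, hxm, hx, -⟩ := hasRegularSequence_succ_iff.1 hM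
    exact maximalIdeal_notMem_associatedPrimes hxm hx
  let I := Module.annihilator R M ⊔ Module.annihilator R B
  have hp : ∀ P ∈ associatedPrimes R M ∪ (I.minimalPrimes \ {maximalIdeal R}), P.IsPrime := by
    rintro P (hP | hP)
    exacts [hP.isPrime, hP.1.1.1]
  -- Besides being M-regular, `y` avoids the non-maximal minimal primes of the intersection.
  -- Dividing by `y` thus lowers the depth of M and the dimension of each such component together,
  -- and `hc` persists for M/yM.
  obtain ⟨y, hym, hy⟩ := exists_mem_forall_notMem (J := maximalIdeal R)
    ((associatedPrimes.finite R M).union (I.finite_minimalPrimes_of_isNoetherianRing.sdiff)) hp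
    (not_maximalIdeal_le hp (by simp [hm]))
  have hyM : IsSMulRegular M y :=
    isSMulRegular_iff_forall_associatedPrimes.2 fun P hP => hy P (Or.inl hP)
  refine ⟨y, hym, fun φ => ?_⟩
  have hS := IsSMulRegular.smulShortComplex_shortExact (M := ModuleCat.of R M) hyM
  -- This group contains the obstruction to dividing `φ` by `y`.
  have hext : ∀ x : Ext (ModuleCat.of R (QuotSMulTop y M)) (dualModule R B) 1, x = 0 := by
    refine fun x => (hM.quotSMulTop hym hyM).ext_dualModule_eq_zero he (c := c) ?_ le_rfl
      (by omega) x
    intro P h1 h2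
    have h1' : Module.annihilator R M ≤ P.asIdeal := le_trans
      (LinearMap.annihilator_le_of_surjective _
        (Submodule.mkQ_surjective (y • (⊤ : Submodule R M)))) h1
    obtain ⟨Q, hQ, hQP⟩ := Ideal.exists_minimalPrimes_le (sup_le h1' h2 : I ≤ P.asIdeal)
    have hyP : y ∈ P.asIdeal := h1 (Module.mem_annihilator.2 fun u => by
      obtain ⟨u, rfl⟩ := Submodule.Quotient.mk_surjective _ u
      rw [← Submodule.Quotient.mk_smul, Submodule.Quotient.mk_eq_zero, mem_smul_top_iff]
      exact ⟨u, rfl⟩)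
    -- At an isolated maximal component the dimension cannot drop; there the strict inequality `hcp`
    -- supplies the bound.
    by_cases hQm : Q = maximalIdeal R
    · have hP : P = ⟨maximalIdeal R, inferInstance⟩ :=
        PrimeSpectrum.ext ((le_maximalIdeal P.2.ne_top).antisymm (hQm ▸ hQP))
      have : IsMax P := by
        rw [hP]
        exact fun P' _ => le_maximalIdeal P'.2.ne_top
      rw [Order.coheight_eq_zero.2 this, zero_add]
      exact_mod_cast Nat.le_of_lt_succ hcp
    · let Q' : PrimeSpectrum R := ⟨Q, hQ.1.1⟩
      have hlt : Q' < P := by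
        refine lt_of_le_of_ne hQP fun heq => ?_
        exact hy Q (Or.inr ⟨hQ, hQm⟩) (heq ▸ hyP : y ∈ Q'.asIdeal)
      have h3 := hc Q' (le_sup_left.trans hQ.1.2) (le_sup_right.trans hQ.1.2)
      have h4 := Order.coheight_add_one_le hlt
      have h5 : (Order.coheight P + c) + 1 ≤ (p : ℕ∞) + 1 := by
        calc Order.coheight P + c + 1 = Order.coheight P + 1 + c := by abel
          _ ≤ Order.coheight Q' + c := by gcongr
          _ ≤ _ := by exact_mod_cast h3
      exact (ENat.add_le_add_iff_right (by simp)).1 h5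
  obtain ⟨x, hx⟩ : ∃ x : Ext (ModuleCat.of R M) (dualModule R B) 0,
      (Ext.mk₀ (y • 𝟙 (ModuleCat.of R M))).comp x (zero_add 0) =
        Ext.mk₀ (ModuleCat.ofHom φ : ModuleCat.of R M ⟶ dualModule R B) :=
    Ext.contravariant_sequence_exact₁ hS (dualModule R B)
      (Ext.mk₀ (ModuleCat.ofHom φ : ModuleCat.of R M ⟶ dualModule R B)) (add_zero 1) (hext _)
  obtain ⟨ψ, rfl⟩ := Ext.homEquiv₀.symm.surjective x
  refine ⟨ψ.hom, ?_⟩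
  rw [mk₀_smul_id_comp] at hx
  have h1 : y • ψ = ModuleCat.ofHom φ := by
    apply Ext.homEquiv₀.symm.injective
    change Ext.mk₀ _ = Ext.mk₀ _
    rw [← hx, Ext.mk₀_smul]
    rfl
  exact congrArg ModuleCat.Hom.hom h1

end Local

end ExtVanishing

/-! ### The polynomial ring and its local ring at the vertex of the cone -/

section PolynomialRing

open RingTheory.Sequence

theorem mem_irrelevant_iff_constantCoeff {N : ℕ} {f : S N} :
    f ∈ (HomogeneousIdeal.irrelevant (grading N)).toIdeal ↔ MvPolynomial.constantCoeff f = 0 := by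
  change f ∈ HomogeneousIdeal.irrelevant (grading N) ↔ _
  rw [HomogeneousIdeal.mem_irrelevant_iff, GradedRing.proj_apply]
  have h : (DirectSum.decompose (grading N) f 0 : S N) = MvPolynomial.homogeneousComponent 0 f :=
    MvPolynomial.decomposition.decompose'_apply f 0
  rw [h]
  rw [MvPolynomial.homogeneousComponent_zero, MvPolynomial.C_eq_zero]
  rfl

theorem irrelevant_eq_ker (N : ℕ) : (HomogeneousIdeal.irrelevant (grading N)).toIdeal =
    RingHom.ker (MvPolynomial.constantCoeff : S N →+* ℂ) :=
  Ideal.ext fun _ => mem_irrelevant_iff_constantCoeff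

theorem irrelevant_eq_span_range_X (N : ℕ) :
    (HomogeneousIdeal.irrelevant (grading N)).toIdeal =
      Ideal.span (Set.range (MvPolynomial.X : Fin (N + 1) → S N)) := by
  ext f
  rw [mem_irrelevant_iff_constantCoeff, ← Set.image_univ, MvPolynomial.mem_ideal_span_X_image]
  constructor
  · intro h m hm
    by_contra! h0
    obtain rfl : m = 0 := by
      ext i
      exact h0 i trivial
    exact MvPolynomial.mem_support_iff.1 hm h
  · intro h
    by_contra h0
    obtain ⟨i, -, hi⟩ := h 0 (MvPolynomial.mem_support_iff.2 h0)
    exact hi rfl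

instance isMaximal_irrelevant (N : ℕ) :
    (HomogeneousIdeal.irrelevant (grading N)).toIdeal.IsMaximal := by
  rw [irrelevant_eq_ker]
  exact RingHom.ker_isMaximal_of_surjective _ fun c => ⟨MvPolynomial.C c, by simp⟩

/-- Membership in an ideal spanned by variables is tested monomial by monomial, and multiplying by
the i-th variable does not change the exponents of the earlier ones. -/
theorem isWeaklyRegular_ofFn_X (A : Type*) [CommRing A] (n : ℕ) :
    IsWeaklyRegular (MvPolynomial (Fin n) A) (List.ofFn (MvPolynomial.X : Fin n → MvPolynomial (Fin n) A)) := by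
  refine ⟨fun i hi => ?_⟩
  have hin : i < n := by simpa using hi
  have hspan : Ideal.ofList ((List.ofFn (MvPolynomial.X : Fin n → MvPolynomial (Fin n) A)).take i) •
      (⊤ : Submodule (MvPolynomial (Fin n) A) (MvPolynomial (Fin n) A)) =
      Ideal.span (MvPolynomial.X '' {j : Fin n | j < i}) := by
    rw [smul_eq_mul, Ideal.mul_top, Ideal.ofList]
    congr 1
    ext f
    simp only [Set.mem_ofPred_eq, List.mem_take_iff_getElem, Set.mem_image, List.length_ofFn,
      List.getElem_ofFn]
    constructor
    · rintro ⟨j, hj, rfl⟩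
      exact ⟨⟨j, by omega⟩, by simp; omega, rfl⟩
    · rintro ⟨j, hj, rfl⟩
      exact ⟨j, by omega, rfl⟩
  rw [hspan, List.getElem_ofFn, isSMulRegular_iff_right_eq_zero_of_smul]
  intro f hf
  obtain ⟨f, rfl⟩ := Ideal.Quotient.mk_surjective f
  replace hf : (Ideal.Quotient.mk _ (MvPolynomial.X ⟨i, hin⟩ * f)) = 0 := hf
  rw [Ideal.Quotient.eq_zero_iff_mem, MvPolynomial.mem_ideal_span_X_image] at hf ⊢
  intro m hm
  obtain ⟨j, hj, hjm⟩ := hf (Finsupp.single ⟨i, hin⟩ 1 + m) (by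
    rw [MvPolynomial.mem_support_iff, MvPolynomial.coeff_X_mul]
    exact MvPolynomial.mem_support_iff.1 hm)
  refine ⟨j, hj, ?_⟩
  have hne : (⟨i, hin⟩ : Fin n) ≠ j := by
    rintro rfl
    simp at hj
  simpa [Finsupp.single_apply, hne] using hjm

/-- The local ring of the affine cone over projective space at its vertex. -/
abbrev VertexRing (N : ℕ) : Type :=
  Localization.AtPrime (HomogeneousIdeal.irrelevant (grading N)).toIdeal

theorem isRegular_vertexRing (N : ℕ) :
    IsRegular (VertexRing N)
      ((List.ofFn (MvPolynomial.X : Fin (N + 1) → S N)).map (algebraMap _ (VertexRing N))) :=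
  (isWeaklyRegular_ofFn_X ℂ (N + 1)).isRegular_of_isLocalization_of_mem _
    (HomogeneousIdeal.irrelevant (grading N)).toIdeal fun f hf => by
      obtain ⟨i, rfl⟩ := (List.mem_ofFn ..).1 hf
      rw [irrelevant_eq_span_range_X]
      exact Ideal.subset_span ⟨i, rfl⟩

theorem ofList_vertexRing (N : ℕ) :
    Ideal.ofList ((List.ofFn (MvPolynomial.X : Fin (N + 1) → S N)).map
      (algebraMap _ (VertexRing N))) = IsLocalRing.maximalIdeal (VertexRing N) := by
  rw [← Ideal.map_ofList, ← Localization.AtPrime.map_eq_maximalIdeal]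
  congr 1
  rw [irrelevant_eq_span_range_X, Ideal.ofList]
  congr 1
  ext f
  simp only [Set.mem_ofPred_eq, List.mem_ofFn, Set.mem_range]

theorem hasRegularSequence_vertexRing (N : ℕ) :
    HasRegularSequence (VertexRing N) (VertexRing N) (N + 1) := by
  refine ⟨_, by simp, fun x hx => ?_, isRegular_vertexRing N⟩
  rw [← ofList_vertexRing]
  exact Ideal.subset_span hx

open Abelian in
-- The residue field is the quotient by the regular sequence of the N + 1 variables, so its
-- projective dimension is N + 1.
theorem ext_residueModule_vertexRing_eq_zero {N : ℕ} (W : ModuleCat.{0} (VertexRing N)) {i : ℕ}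
    (hi : N + 1 < i) (e : Ext (residueModule (VertexRing N)) W i) : e = 0 := by
  have h := ModuleCat.projectiveDimension_quotient_eq_length.{0} _ (isRegular_vertexRing N)
  rw [ofList_vertexRing, projectiveDimension_eq_of_iso
    (Shrink.linearEquiv (VertexRing N) _).toModuleIso] at h
  have h' : HasProjectiveDimensionLT (residueModule (VertexRing N)) (N + 2) := by
    rw [← projectiveDimension_lt_iff, h]
    simp
    norm_cast
    omega
  exact Ext.eq_zero_of_hasProjectiveDimensionLT e (N + 2) hi

end PolynomialRing

/-! ### Passing between a ring and its localization, and between Hom into duals and tensor products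
-/

section Transfer

universe u

open Abelian TensorProduct

variable {A : Type u} [CommRing A] {T : Submonoid A}

/-- The Hom complex into a module over a localization can be computed before localizing. -/
theorem exists_comp_eq_of_ext_localizedModule_eq_zero {E : ModuleCat.{u} A}
    (P : ProjectiveResolution E) (W : ModuleCat.{u} (Localization T)) [Module A W]
    [IsScalarTower A (Localization T) W] {n : ℕ}
    (h : ∀ e : Ext (E.localizedModule T) W (n + 1), e = 0) (φ : P.complex.X (n + 1) →ₗ[A] W)
    (hφ : φ ∘ₗ (P.complex.d (n + 2) (n + 1)).hom = 0) :
    ∃ ψ : P.complex.X n →ₗ[A] W, ψ ∘ₗ (P.complex.d (n + 1) n).hom = φ := by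
  have hW : IsLocalizedModule T (LinearMap.id : W →ₗ[A] W) := isLocalizedModule_id T W (Localization T)
  have hunits := IsLocalizedModule.map_units (S := T) (LinearMap.id : W →ₗ[A] W)
  let Q := (ModuleCat.localizedModuleFunctor.{u} T).mapProjectiveResolution P
  let _ (i : ℕ) : Module A (Q.complex.X i) :=
    (inferInstance : Module A ((P.complex.X i).localizedModule T))
  have _ (i : ℕ) : IsScalarTower A (Localization T) (Q.complex.X i) :=
    inferInstanceAs (IsScalarTower A (Localization T) ((P.complex.X i).localizedModule T))
  let ι (i : ℕ) := (P.complex.X i).localizedModuleMkLinearMap T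
  let φ' : Q.complex.X (n + 1) ⟶ W := ModuleCat.ofHom
    ((IsLocalizedModule.lift T (ι (n + 1)) φ hunits).extendScalarsOfIsLocalization T
      (Localization T))
  have hφ' : ∀ x, φ'.hom (ι (n + 1) x) = φ x := fun x =>
    IsLocalizedModule.lift_apply T (ι (n + 1)) φ hunits x
  have hd : ∀ i j x, (Q.complex.d i j).hom (ι i x) = ι j ((P.complex.d i j).hom x) := fun i j x =>
    IsLocalizedModule.map_apply T (ι i) (ι j) (P.complex.d i j).hom x
  have h0 : Q.complex.d (n + 2) (n + 1) ≫ φ' = 0 := by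
    have : (Q.complex.d (n + 2) (n + 1) ≫ φ').hom.restrictScalars A = 0 := by
      refine IsLocalizedModule.ext T (ι (n + 2)) hunits (LinearMap.ext fun x => ?_)
      change φ'.hom ((Q.complex.d (n + 2) (n + 1)).hom (ι (n + 2) x)) = 0
      rw [hd, hφ']
      exact LinearMap.congr_fun hφ x
    ext x
    exact LinearMap.congr_fun this x
  -- The localized resolution `Q` computes Ext over the localization, so the cocycle `φ'` is a
  -- coboundary there.
  obtain ⟨g, hg⟩ := (Q.extMk_eq_zero_iff φ' (n + 2) rfl h0 n rfl).1 (h _)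
  refine ⟨g.hom.restrictScalars A ∘ₗ ι n, LinearMap.ext fun x => ?_⟩
  change g.hom (ι n ((P.complex.d (n + 1) n).hom x)) = φ x
  rw [← hd, ← hφ', ← hg]
  rfl

/-- Exactness after tensoring with `B` is tested by linear maps into the dual of `B`. -/
theorem exact_rTensor_of_dual {B X₁ X₂ X₃ : Type u} [AddCommGroup B] [AddCommGroup X₁]
    [AddCommGroup X₂] [AddCommGroup X₃] [Module A B] [Module A X₁] [Module A X₂] [Module A X₃]
    {f : X₁ →ₗ[A] X₂} {g : X₂ →ₗ[A] X₃} (hfg : g ∘ₗ f = 0)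
    (h : ∀ φ : X₂ →ₗ[A] CharacterModule B, φ ∘ₗ f = 0 →
      ∃ ψ : X₃ →ₗ[A] CharacterModule B, ψ ∘ₗ g = φ) :
    Function.Exact (f.rTensor B) (g.rTensor B) := by
  refine LinearMap.exact_of_comp_of_mem_range ?_ fun z hz => ?_
  · rw [← LinearMap.rTensor_comp, hfg, LinearMap.rTensor_zero]
  -- It suffices that every character of the cokernel of f ⊗ B kills the class of `z`. By tensor-hom
  -- adjunction such a character is a map X₂ → B* vanishing on the image of `f`; by hypothesis it
  -- factors through `g`, and (g ⊗ B) z = 0.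
  rw [← Submodule.Quotient.mk_eq_zero]
  refine CharacterModule.eq_zero_of_character_apply fun c => ?_
  let c' : CharacterModule (X₂ ⊗[A] B) := CharacterModule.dual (Submodule.mkQ _) c
  obtain ⟨ψ, hψ⟩ := h (CharacterModule.curry c') (by
    ext x b
    change c (Submodule.Quotient.mk (f x ⊗ₜ b)) = 0
    have : (Submodule.Quotient.mk (f x ⊗ₜ[A] b) : (X₂ ⊗[A] B) ⧸ LinearMap.range (f.rTensor B)) = 0 :=
      (Submodule.Quotient.mk_eq_zero _).2 ⟨x ⊗ₜ b, rfl⟩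
    rw [this, map_zero])
  have key : c' = CharacterModule.dual (g.rTensor B) (CharacterModule.uncurry ψ) := by
    apply CharacterModule.homEquiv.symm.injective
    exact hψ.symm
  change c' z = 0
  rw [key]
  change CharacterModule.uncurry ψ (g.rTensor B z) = 0
  rw [hz, map_zero]

/-- Multiplication by `y` is injective on `M ⊗ B` if `y` acts surjectively on the linear maps
from `M` into the dual of `B`. -/
theorem smul_eq_zero_of_dual {B M : Type u} [AddCommGroup B] [AddCommGroup M] [Module A B]
    [Module A M] {y : A} (h : ∀ φ : M →ₗ[A] CharacterModule B,
      ∃ ψ : M →ₗ[A] CharacterModule B, y • ψ = φ) {z : M ⊗[A] B} (hz : y • z = 0) : z = 0 := by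
  refine CharacterModule.eq_zero_of_character_apply fun c => ?_
  obtain ⟨c, rfl⟩ := CharacterModule.homEquiv.surjective c
  obtain ⟨ψ, rfl⟩ := h c
  rw [map_smul, CharacterModule.smul_apply, hz, map_zero]

/-- Linear maps from a module to a module over a localization may be divided by `y` if this holds
after localization. -/
theorem exists_smul_eq_of_isLocalizedModule {M M' W : Type u} [AddCommGroup M] [AddCommGroup M']
    [AddCommGroup W] [Module A M] [Module A M'] [Module (Localization T) M']
    [IsScalarTower A (Localization T) M'] [Module A W] [Module (Localization T) W]
    [IsScalarTower A (Localization T) W] (ι : M →ₗ[A] M') [IsLocalizedModule T ι] {y : A}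
    (h : ∀ φ : M' →ₗ[Localization T] W, ∃ ψ : M' →ₗ[Localization T] W,
      algebraMap A (Localization T) y • ψ = φ) (φ : M →ₗ[A] W) : ∃ ψ : M →ₗ[A] W, y • ψ = φ := by
  have hW : IsLocalizedModule T (LinearMap.id : W →ₗ[A] W) := isLocalizedModule_id T W (Localization T)
  have hunits := IsLocalizedModule.map_units (S := T) (LinearMap.id : W →ₗ[A] W)
  obtain ⟨ψ, hψ⟩ := h ((IsLocalizedModule.lift T ι φ hunits).extendScalarsOfIsLocalization T
    (Localization T))
  refine ⟨ψ.restrictScalars A ∘ₗ ι, LinearMap.ext fun x => ?_⟩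
  have := LinearMap.congr_fun hψ (ι x)
  simp only [LinearMap.smul_apply, algebraMap_smul] at this
  change y • ψ (ι x) = φ x
  rw [this]
  exact IsLocalizedModule.lift_apply T ι φ hunits x

instance isScalarTower_characterModule {R : Type*} [CommRing R] [Algebra A R] {B : Type*}
    [AddCommGroup B] [Module A B] [Module R B] [IsScalarTower A R B] :
    IsScalarTower A R (CharacterModule B) :=
  ⟨fun x r c => CharacterModule.ext (A := B) fun b => by
    rw [CharacterModule.smul_apply, CharacterModule.smul_apply, CharacterModule.smul_apply,
      smul_assoc, smul_comm]⟩

end Transfer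

/-! ### Cohen–Macaulay quotients seen over the localized ambient ring -/

section LocalizedQuotient

universe u

open IsLocalRing RingTheory.Sequence

/-- If `A ⧸ I` is Cohen–Macaulay, the localization of `A ⧸ I` at a prime `𝔪` containing `I` has
a regular sequence, over the localization of `A`, whose length bounds the dimensions of the
irreducible closed subsets of its support. -/
theorem exists_hasRegularSequence_of_isCohenMacaulayRing {A : Type u} [CommRing A]
    {𝔪 I : Ideal A} [𝔪.IsPrime] (hI : I ≤ 𝔪) (hCM : IsCohenMacaulayRing (A ⧸ I)) :
    ∃ p : ℕ, (∀ (M : Type u) [AddCommGroup M] [Module A M] [Module (Localization.AtPrime 𝔪) M]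
      [IsScalarTower A (Localization.AtPrime 𝔪) M] (ι : A ⧸ I →ₗ[A] M)
      [IsLocalizedModule 𝔪.primeCompl ι], HasRegularSequence (Localization.AtPrime 𝔪) M p) ∧
    ∀ P : PrimeSpectrum (Localization.AtPrime 𝔪),
      I.map (algebraMap A (Localization.AtPrime 𝔪)) ≤ P.asIdeal → Order.coheight P ≤ p := by
  let R := Localization.AtPrime 𝔪
  let 𝔭 : Ideal (A ⧸ I) := 𝔪.map (Ideal.Quotient.mk I)
  have h𝔭 : 𝔭.IsPrime := Ideal.isPrime_map_quotientMk_of_isPrime hI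
  have hcomap : 𝔪 = 𝔭.comap (algebraMap A (A ⧸ I)) := (Ideal.comap_map_mk hI).symm
  have hover : 𝔭.LiesOver 𝔪 := ⟨hcomap⟩
  let C := Localization.AtPrime 𝔭
  have hsub := Ideal.algebraMapSubmonoid_primeCompl_of_liesOver_surjective 𝔭 𝔪
    (Ideal.Quotient.mk_surjective (I := I))
  -- Localizing A/I as a ring at the image of 𝔪 agrees with localizing it as an A-module at 𝔪.
  have hC : IsLocalization (Algebra.algebraMapSubmonoid (A ⧸ I) 𝔪.primeCompl) C := by
    rw [hsub]
    infer_instance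
  let φ : R →+* C := Localization.localRingHom 𝔪 𝔭 (algebraMap A (A ⧸ I)) hcomap
  let _ : Algebra R C := φ.toAlgebra
  have htower : IsScalarTower A R C := IsScalarTower.of_algebraMap_eq fun x =>
    (Localization.localRingHom_to_map 𝔪 𝔭 (algebraMap A (A ⧸ I)) hcomap x).symm
  have hC' : IsLocalizedModule 𝔪.primeCompl (IsScalarTower.toAlgHom A (A ⧸ I) C).toLinearMap :=
    inferInstance
  have hφ : Function.Surjective (algebraMap R C) := by
    intro z
    obtain ⟨⟨a, s⟩, rfl⟩ := IsLocalizedModule.mk'_surjective 𝔪.primeCompl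
      (IsScalarTower.toAlgHom A (A ⧸ I) C).toLinearMap z
    obtain ⟨a, rfl⟩ := Ideal.Quotient.mk_surjective a
    refine ⟨IsLocalization.mk' R a s, ?_⟩
    change _ = IsLocalizedModule.mk' _ _ _
    rw [eq_comm, IsLocalizedModule.mk'_eq_iff]
    change algebraMap (A ⧸ I) C (algebraMap A (A ⧸ I) a) = (s : A) • algebraMap R C _
    rw [← IsScalarTower.algebraMap_apply, ← algebraMap_smul R (s : A), Algebra.smul_def,
      ← map_mul, IsLocalization.mk'_spec', ← IsScalarTower.algebraMap_apply]
  obtain ⟨-, rs, hrs, hreg, hdim⟩ := hCM.2 𝔭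
  refine ⟨rs.length, fun M _ _ _ _ ι _ => ?_, fun P hP => ?_⟩
  · let e : M ≃ₗ[R] C := (IsLocalizedModule.linearEquiv 𝔪.primeCompl ι
      (IsScalarTower.toAlgHom A (A ⧸ I) C).toLinearMap).extendScalarsOfIsLocalization 𝔪.primeCompl R
    refine HasRegularSequence.congr e.symm ?_
    -- The regular sequence of `C` lifts along the surjection from `R`; preimages of non-units are
    -- non-units.
    obtain ⟨rs, rfl⟩ := List.map_surjective_iff.2 hφ rs
    have hmem : ∀ x ∈ rs, x ∈ maximalIdeal R := fun x hx hu =>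
      hrs _ (List.mem_map_of_mem hx) (hu.map (algebraMap R C))
    have : Module.Finite R C := Module.Finite.of_surjective (Algebra.linearMap R C) hφ
    refine ⟨rs, by simp, hmem,
      (IsLocalRing.isRegular_iff_isWeaklyRegular_of_subset_maximalIdeal hmem).2 ?_⟩
    exact (isWeaklyRegular_map_algebraMap_iff C C rs).1 hreg.1
  · have hker : RingHom.ker (algebraMap R C) ≤ P.asIdeal := by
      intro z hz
      obtain ⟨⟨a, s⟩, rfl⟩ := IsLocalization.mk'_surjective 𝔪.primeCompl z
      rw [RingHom.mem_ker] at hz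
      have h1 : algebraMap (A ⧸ I) C (algebraMap A (A ⧸ I) a) = 0 := by
        rw [← IsScalarTower.algebraMap_apply, IsScalarTower.algebraMap_apply A R C,
          ← IsLocalization.mk'_spec R a s, map_mul, hz, zero_mul]
      obtain ⟨⟨t, ht⟩, h2⟩ := (IsLocalization.map_eq_zero_iff
        (Algebra.algebraMapSubmonoid (A ⧸ I) 𝔪.primeCompl) C _).1 h1
      obtain ⟨t, ht, rfl⟩ := ht
      have h3 : t * a ∈ I := Ideal.Quotient.eq_zero_iff_mem.1 (by rw [map_mul]; exact h2)
      have h4 : algebraMap A R t * algebraMap A R a ∈ P.asIdeal := by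
        rw [← map_mul]
        exact hP (Ideal.mem_map_of_mem _ h3)
      have hu : ∀ t ∈ 𝔪.primeCompl, algebraMap A R t ∉ P.asIdeal := fun t ht hm =>
        P.2.ne_top (Ideal.eq_top_of_isUnit_mem _ hm (IsLocalization.map_units R ⟨t, ht⟩))
      have h5 := (P.2.mem_or_mem h4).resolve_left (hu t ht)
      rw [← IsLocalization.mk'_spec R a s] at h5
      exact (P.2.mem_or_mem h5).resolve_right (hu s s.2)
    -- Primes above `P` contain the kernel of R → C, hence are primes of `C`, whose dimension is the
    -- length of the sequence.
    have h1 : ((Order.coheight P : ℕ∞) : WithBot ℕ∞) ≤ ringKrullDim C := by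
      rw [ringKrullDim_eq_of_ringEquiv (RingHom.quotientKerEquivOfSurjective hφ).symm,
        ringKrullDim_quotient, Order.coheight_eq_krullDim_Ici]
      exact Order.krullDim_le_of_strictMono (fun Q => ⟨Q.1, fun x hx => Q.2 (hker hx)⟩)
        fun _ _ h => h
    rw [← hdim] at h1
    exact WithBot.coe_le_coe.1 h1

end LocalizedQuotient

/-! ### Injectivity on Tor for quotients of the polynomial ring -/

section TorInjective

universe u

open IsLocalRing RingTheory.Sequence TensorProduct MonoidalCategory Abelian

theorem map_le_annihilator_of_isLocalizedModule {A : Type u} [CommRing A] {T : Submonoid A}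
    {L : Ideal A} {M : Type u} [AddCommGroup M] [Module A M] [Module (Localization T) M]
    [IsScalarTower A (Localization T) M] (ι : A ⧸ L →ₗ[A] M) [IsLocalizedModule T ι] :
    L.map (algebraMap A (Localization T)) ≤ Module.annihilator (Localization T) M := by
  rw [Ideal.map_le_iff_le_comap]
  intro f hf
  rw [Ideal.mem_comap, Module.mem_annihilator]
  intro u
  obtain ⟨⟨a, s⟩, rfl⟩ := IsLocalizedModule.mk'_surjective T ι u
  obtain ⟨a, rfl⟩ := Ideal.Quotient.mk_surjective a
  rw [algebraMap_smul]
  change f • IsLocalizedModule.mk' ι _ s = 0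
  rw [← IsLocalizedModule.mk'_smul]
  have : f • (Ideal.Quotient.mk L a) = 0 :=
    Ideal.Quotient.eq_zero_iff_mem.2 (L.mul_mem_right a hf)
  rw [this, IsLocalizedModule.mk'_zero]

/-- An element of the maximal ideal of a localization acting surjectively on the linear maps into
the dual of `B` may be taken from the ring, and then acts injectively on the tensor product
with `B`. -/
theorem exists_mem_smul_injective {A : Type u} [CommRing A] {𝔪 : Ideal A} [𝔪.IsPrime]
    {E M B : Type u} [AddCommGroup E] [Module A E] [AddCommGroup M] [Module A M]
    [Module (Localization.AtPrime 𝔪) M] [IsScalarTower A (Localization.AtPrime 𝔪) M]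
    [AddCommGroup B] [Module A B]
    [Module (Localization.AtPrime 𝔪) B] [IsScalarTower A (Localization.AtPrime 𝔪) B]
    (ι : E →ₗ[A] M) [IsLocalizedModule 𝔪.primeCompl ι]
    (h : ∃ y ∈ maximalIdeal (Localization.AtPrime 𝔪),
      ∀ φ : M →ₗ[Localization.AtPrime 𝔪] CharacterModule B,
        ∃ ψ : M →ₗ[Localization.AtPrime 𝔪] CharacterModule B, y • ψ = φ) :
    ∃ y ∈ 𝔪, ∀ z : E ⊗[A] B, y • z = 0 → z = 0 := by
  obtain ⟨y, hym, hy⟩ := h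
  obtain ⟨⟨a, s⟩, rfl⟩ := IsLocalization.mk'_surjective 𝔪.primeCompl y
  refine ⟨a, ?_, fun z hz => smul_eq_zero_of_dual (fun φ =>
    exists_smul_eq_of_isLocalizedModule (T := 𝔪.primeCompl) ι (y := a) (fun φ => ?_) φ) hz⟩
  · exact (IsLocalization.AtPrime.mk'_mem_maximal_iff _ 𝔪 a s).1 hym
  · obtain ⟨ψ, rfl⟩ := hy φ
    -- The unit 1/s of the fraction a/s is absorbed into `ψ`, which leaves the numerator `a` as the
    -- required element.
    refine ⟨IsLocalization.mk' (Localization.AtPrime 𝔪) 1 s • ψ, ?_⟩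
    rw [smul_smul]
    congr 1
    exact (IsLocalization.mk'_eq_mul_mk'_one a s).symm

/-- The category-theoretic criterion for cyclic modules. -/
theorem mono_tor'_map_factor_of_exact {A : Type u} [CommRing A] {I K 𝔪 : Ideal A} (hIK : I ≤ K)
    {B : Type u} [AddCommGroup B] [Module A B] (b : B) (ρ : B →ₗ[A] A ⧸ 𝔪) (hρ : ρ b = 1)
    (hK : ∀ f ∈ K, f • ((1 : A ⧸ I) ⊗ₜ[A] b) = 0)
    (h : ∀ (P : ProjectiveResolution (ModuleCat.of A (A ⧸ I))) (n : ℕ),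
      Function.Exact ((P.complex.d (n + 2) (n + 1)).hom.rTensor B)
        ((P.complex.d (n + 1) n).hom.rTensor B)) (t : ℕ) :
    Mono (((Tor' (ModuleCat.{u} A) t).map
      (ModuleCat.ofHom (Submodule.factor hIK) : ModuleCat.of A (A ⧸ I) ⟶
        ModuleCat.of A (A ⧸ K))).app (ModuleCat.of A (A ⧸ 𝔪))) := by
  let E := ModuleCat.of A (A ⧸ I)
  let k := ModuleCat.of A (A ⧸ 𝔪)
  let η : 𝟙_ (ModuleCat.{u} A) ⟶ ModuleCat.of A B := ModuleCat.ofHom (LinearMap.toSpanSingleton A B b)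
  let r : ModuleCat.of A B ⊗ k ⟶ k :=
    ModuleCat.ofHom (LinearMap.mul' A (A ⧸ 𝔪) ∘ₗ ρ.rTensor (A ⧸ 𝔪))
  let β : ModuleCat.of A (A ⧸ K) ⟶ E ⊗ ModuleCat.of A B := ModuleCat.ofHom
    (Submodule.liftQ K (LinearMap.toSpanSingleton A _ ((1 : A ⧸ I) ⊗ₜ[A] b)) fun f hf => hK f hf)
  let P := projectiveResolution E
  have hsurj : Function.Surjective ((augmentation P).hom.rTensor B) :=
    LinearMap.rTensor_surjective _ ((ModuleCat.epi_iff_surjective _).1 inferInstance)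
  refine mono_tor'_map _ η r ?_ β ?_ P ?_ ?_ ?_ t
  · refine ModuleCat.MonoidalCategory.tensor_ext fun a u => ?_
    change ρ (a • b) * u = a • u
    rw [map_smul, hρ, smul_mul_assoc, one_mul]
  · ext
    change (1 : A) • ((1 : A ⧸ I) ⊗ₜ[A] b) = (1 : A ⧸ I) ⊗ₜ[A] ((1 : A) • b)
    rw [one_smul, one_smul]
  · exact (ModuleCat.epi_iff_surjective _).2 hsurj
  · rw [ShortComplex.ShortExact.moduleCat_exact_iff_function_exact]
    have := (exact_augmentation P)
    rw [ShortComplex.ShortExact.moduleCat_exact_iff_function_exact] at this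
    -- Right exactness of the tensor product settles the augmentation; only the higher degrees need
    -- `h`.
    exact rTensor_exact B this ((ModuleCat.epi_iff_surjective _).1 inferInstance)
  · intro n
    rw [ShortComplex.ShortExact.moduleCat_exact_iff_function_exact]
    exact h P n

/-- Two ideals of the homogeneous coordinate ring of projective space which meet properly at the
vertex with good depth, and an ideal `K` with the same saturation as their sum: the map
`Tor(S ⧸ I, S ⧸ S₊) ⟶ Tor(S ⧸ K, S ⧸ S₊)` is injective. -/
theorem mono_tor'_map_factor {N : ℕ} {I J K : Ideal (S N)} (hIK : I ≤ K)
    (hJ : J ≤ (HomogeneousIdeal.irrelevant (grading N)).toIdeal)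
    (hK : ∀ f ∈ K, ∀ y ∈ (HomogeneousIdeal.irrelevant (grading N)).toIdeal,
      ∃ e : ℕ, y ^ e * f ∈ I ⊔ J)
    {p q r : ℕ} (hq : q ≤ N + 1) (hr : 1 ≤ r) (hpq : N + 1 + r ≤ p + q)
    (hM : HasRegularSequence (VertexRing N) ((ModuleCat.of (S N) (S N ⧸ I)).localizedModule
      (HomogeneousIdeal.irrelevant (grading N)).toIdeal.primeCompl) p)
    (hB : HasRegularSequence (VertexRing N) ((ModuleCat.of (S N) (S N ⧸ J)).localizedModule
      (HomogeneousIdeal.irrelevant (grading N)).toIdeal.primeCompl) q)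
    (hdim : ∀ P : PrimeSpectrum (VertexRing N), I.map (algebraMap _ (VertexRing N)) ≤ P.asIdeal →
      J.map (algebraMap _ (VertexRing N)) ≤ P.asIdeal → Order.coheight P ≤ r) (t : ℕ) :
    Mono (((Tor' (ModuleCat.{0} (S N)) t).map
      (ModuleCat.ofHom (Submodule.factor hIK) : ModuleCat.of (S N) (S N ⧸ I) ⟶
        ModuleCat.of (S N) (S N ⧸ K))).app (resField N)) := by
  set 𝔪 := (HomogeneousIdeal.irrelevant (grading N)).toIdeal with h𝔪
  have h𝔪max : 𝔪.IsMaximal := isMaximal_irrelevant N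
  let E := ModuleCat.of (S N) (S N ⧸ I)
  let F := ModuleCat.of (S N) (S N ⧸ J)
  set M : ModuleCat.{0} (VertexRing N) := E.localizedModule 𝔪.primeCompl
  set B : ModuleCat.{0} (VertexRing N) := F.localizedModule 𝔪.primeCompl
  let _ : Module (S N) M := inferInstanceAs (Module (S N) (E.localizedModule 𝔪.primeCompl))
  let _ : Module (S N) B := inferInstanceAs (Module (S N) (F.localizedModule 𝔪.primeCompl))
  have : IsScalarTower (S N) (VertexRing N) M :=
    inferInstanceAs (IsScalarTower (S N) (Localization 𝔪.primeCompl)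
      (E.localizedModule 𝔪.primeCompl))
  have : IsScalarTower (S N) (VertexRing N) B :=
    inferInstanceAs (IsScalarTower (S N) (Localization 𝔪.primeCompl)
      (F.localizedModule 𝔪.primeCompl))
  let ιM : S N ⧸ I →ₗ[S N] M := E.localizedModuleMkLinearMap 𝔪.primeCompl
  let ιB : S N ⧸ J →ₗ[S N] B := F.localizedModuleMkLinearMap 𝔪.primeCompl
  have hιM : IsLocalizedModule 𝔪.primeCompl ιM :=
    ModuleCat.localizedModule_isLocalizedModule E 𝔪.primeCompl
  have hιB : IsLocalizedModule 𝔪.primeCompl ιB :=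
    ModuleCat.localizedModule_isLocalizedModule F 𝔪.primeCompl
  have hMfin : Module.Finite (VertexRing N) M :=
    Module.Finite.of_isLocalizedModule 𝔪.primeCompl ιM
  have hBfin : Module.Finite (VertexRing N) B :=
    Module.Finite.of_isLocalizedModule 𝔪.primeCompl ιB
  have hBnt : Nontrivial B := hB.nontrivial
  have hext : ∀ (W : ModuleCat.{0} (VertexRing N)) (i : ℕ), N + 1 - q < i →
      ∀ x : Ext W (dualModule (VertexRing N) B) i, x = 0 := fun W i hi x =>
    ext_dualModule_eq_zero (fun x => hB.ext_residueModule_dualModule_eq_zero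
      (fun W i hi e => ext_residueModule_vertexRing_eq_zero W hi e) (by omega) x) W hi x
  -- The excess of the depth `p` over the dimension bound `r` is at least the injective dimension
  -- bound N + 1 - q. Because r ≥ 1, also N + 1 - q < p, as needed for the element `y` below.
  have hc : ∀ P : PrimeSpectrum (VertexRing N), Module.annihilator (VertexRing N) M ≤ P.asIdeal →
      Module.annihilator (VertexRing N) B ≤ P.asIdeal →
      Order.coheight P + (N + 1 - q : ℕ) ≤ p := by
    intro P h1 h2
    calc Order.coheight P + (N + 1 - q : ℕ) ≤ (r : ℕ∞) + (N + 1 - q : ℕ) := by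
          gcongr
          exact hdim P ((map_le_annihilator_of_isLocalizedModule ιM).trans h1)
            ((map_le_annihilator_of_isLocalizedModule ιB).trans h2)
      _ ≤ p := by
          norm_cast
          omega
  have hvan : ∀ i, 1 ≤ i → ∀ x : Ext M (dualModule (VertexRing N) B) i, x = 0 := fun i hi x =>
    hM.ext_dualModule_eq_zero hext hc hi (by omega) x
  obtain ⟨y, hy, hyinj⟩ := exists_mem_smul_injective (B := B) ιM
    (hM.exists_smul_hom_surjective hext hc (by omega) le_rfl)
  have hkill : ∀ f ∈ I ⊔ J, f • ((1 : S N ⧸ I) ⊗ₜ[S N] ιB 1) = 0 := by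
    intro f hf
    obtain ⟨g, hg, h, hh, rfl⟩ := Submodule.mem_sup.1 hf
    have h1 : g • (1 : S N ⧸ I) = 0 := Ideal.Quotient.eq_zero_iff_mem.2 (I.mul_mem_right 1 hg)
    have h2 : h • (1 : S N ⧸ J) = 0 := Ideal.Quotient.eq_zero_iff_mem.2 (J.mul_mem_right 1 hh)
    rw [add_smul, TensorProduct.smul_tmul', h1, TensorProduct.zero_tmul, zero_add,
      ← TensorProduct.tmul_smul, ← map_smul, h2, map_zero, TensorProduct.tmul_zero]
  have hunits : ∀ x : 𝔪.primeCompl,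
      IsUnit (algebraMap (S N) (Module.End (S N) (S N ⧸ 𝔪)) x) := by
    intro x
    let _ : Field (S N ⧸ 𝔪) := Ideal.Quotient.field 𝔪
    have hx : Ideal.Quotient.mk 𝔪 x ≠ 0 := fun h => x.2 (Ideal.Quotient.eq_zero_iff_mem.1 h)
    rw [Module.End.isUnit_iff]
    constructor
    · intro u v huv
      exact mul_left_cancel₀ hx huv
    · exact fun u => ⟨(Ideal.Quotient.mk 𝔪 x)⁻¹ * u, mul_inv_cancel_left₀ hx u⟩
  -- Elements outside 𝔪 act invertibly on S/𝔪, so the quotient map from S/J extends to the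
  -- localization `B`.
  let ρ : B →ₗ[S N] S N ⧸ 𝔪 := IsLocalizedModule.lift 𝔪.primeCompl ιB (Submodule.factor hJ) hunits
  refine mono_tor'_map_factor_of_exact hIK (ιB 1) ρ
    (IsLocalizedModule.lift_apply 𝔪.primeCompl ιB (Submodule.factor hJ) hunits 1) ?_ ?_ t
  · intro f hf
    obtain ⟨e, he⟩ := hK f hf y hy
    have h1 := hkill _ he
    clear he
    -- Since `y` is injective on S/I ⊗ B, powers of `y` can be stripped one at a time.
    induction e with
    | zero => simpa using h1
    | succ e ih =>
      refine ih (hyinj _ ?_)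
      rw [smul_smul, ← mul_assoc, ← pow_succ']
      exact h1
  · intro P n
    refine exact_rTensor_of_dual ?_ fun φ hφ => ?_
    · rw [← ModuleCat.hom_comp, P.complex.d_comp_d]
      rfl
    · have : IsScalarTower (S N) (Localization 𝔪.primeCompl) (dualModule (VertexRing N) B) :=
        isScalarTower_characterModule (R := VertexRing N) (B := B)
      exact exists_comp_eq_of_ext_localizedModule_eq_zero (T := 𝔪.primeCompl) P
        (dualModule (VertexRing N) B) (hvan (n + 1) (by omega)) φ hφ

end TorInjective

/-! ### Homogeneous primes, points of projective space and codimension -/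

section Heights

variable {N : ℕ}

/-- Containment of a homogeneous ideal is tested on homogeneous elements. -/
theorem le_iff_of_isHomogeneous {I J : Ideal (S N)} (hI : I.IsHomogeneous (grading N)) :
    I ≤ J ↔ ∀ (m : ℕ) (f : S N), f ∈ grading N m → f ∈ I → f ∈ J := by
  refine ⟨fun h m f _ hf => h hf, fun h f hf => ?_⟩
  rw [← DirectSum.sum_support_decompose (grading N) f]
  exact J.sum_mem fun i _ => h i _ (SetLike.coe_mem _) (hI i hf)

/-- The homogeneous core of a prime is prime and still contains `I`, so minimality makes it all of
`P`. -/
theorem isHomogeneous_of_mem_minimalPrimes {I P : Ideal (S N)}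
    (hI : I.IsHomogeneous (grading N)) (hP : P ∈ I.minimalPrimes) :
    P.IsHomogeneous (grading N) := by
  have h1 : (P.homogeneousCore (grading N)).toIdeal.IsPrime := hP.1.1.homogeneousCore
  have h2 : I ≤ (P.homogeneousCore (grading N)).toIdeal := by
    rw [← hI.toIdeal_homogeneousCore_eq_self]
    exact Ideal.homogeneousCore_mono (grading N) hP.1.2
  have h3 := (P.toIdeal_homogeneousCore_le (grading N)).antisymm
    (hP.2 ⟨h1, h2⟩ (P.toIdeal_homogeneousCore_le (grading N)))
  rw [← h3]
  exact (P.homogeneousCore (grading N)).isHomogeneous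

/-- A proper homogeneous ideal is contained in the irrelevant ideal. -/
theorem le_irrelevant_of_isHomogeneous {I : Ideal (S N)} (hI : I.IsHomogeneous (grading N))
    (hne : I ≠ ⊤) : I ≤ (HomogeneousIdeal.irrelevant (grading N)).toIdeal := by
  rw [le_iff_of_isHomogeneous hI]
  intro m f hfm hf
  rcases Nat.eq_zero_or_pos m with rfl | hm
  · rw [mem_irrelevant_iff_constantCoeff]
    by_contra h0
    have hfC : f = MvPolynomial.C (MvPolynomial.constantCoeff f) := by
      have h1 := (MvPolynomial.mem_homogeneousSubmodule 0 f).1 hfm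
      exact (MvPolynomial.totalDegree_eq_zero_iff_eq_C.1 (Nat.le_zero.1 h1.totalDegree_le))
    refine hne (Ideal.eq_top_of_isUnit_mem _ hf ?_)
    rw [hfC]
    exact (isUnit_iff_ne_zero.2 h0).map MvPolynomial.C
  · exact HomogeneousIdeal.mem_irrelevant_of_mem _ hm hfm

/-- Below a homogeneous prime, chains of primes can be replaced by chains of homogeneous primes. -/
theorem exists_ltSeries_isHomogeneous {I : Ideal (S N)} (hI : I.IsHomogeneous (grading N))
    (l : LTSeries (PrimeSpectrum (S N))) (hl : I ≤ l.head.asIdeal)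
    (hlast : l.last.asIdeal.IsHomogeneous (grading N)) :
    ∃ l' : LTSeries (PrimeSpectrum (S N)), l'.length = l.length ∧ l'.last = l.last ∧
      I ≤ l'.head.asIdeal ∧ ∀ i, (l' i).asIdeal.IsHomogeneous (grading N) := by
  induction hn : l.length generalizing I l with
  | zero =>
    have hhead : l.head = l.last := by
      change l 0 = l (Fin.last _)
      congr 1
      ext
      simp [hn]
    refine ⟨RelSeries.singleton _ l.last, rfl, rfl, hhead ▸ hl, fun i => hlast⟩
  | succ n ih =>
    have hn0 : l.length ≠ 0 := by omega
    obtain ⟨Q, hQ, hQle⟩ := Ideal.exists_minimalPrimes_le hl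
    have hQhom := isHomogeneous_of_mem_minimalPrimes hI hQ
    let Q' : PrimeSpectrum (S N) := ⟨Q, hQ.1.1⟩
    have hQ1 : Q' < (l.tail hn0).head := by
      rw [RelSeries.head_tail]
      refine lt_of_le_of_lt hQle (l.strictMono ?_)
      rw [Fin.one_eq_mk_of_lt (show 1 < l.length + 1 by omega)]
      exact Nat.one_pos
    let l₁ : LTSeries (PrimeSpectrum (S N)) := (l.tail hn0).cons Q' hQ1
    have hl₁last : l₁.last = l.last := by
      rw [RelSeries.last_cons, RelSeries.last_tail]
    have hl₁len : l₁.length = n + 1 := by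
      simp [l₁, hn]
    -- After the bottom prime is replaced by a homogeneous minimal prime `Q`, a form `a` in the top
    -- prime but not in `Q` is chosen. The chain is rebuilt so that its second member contains `a`,
    -- and induction applies to the homogeneous ideal Q + (a); as `a` is not in `Q`, `Q` stays
    -- strictly below the new chain.
    obtain ⟨m, a, ham, hal, haQ⟩ : ∃ (m : ℕ) (a : S N), a ∈ grading N m ∧
        a ∈ l.last.asIdeal ∧ a ∉ Q := by
      by_contra! h
      have h1 : l.last.asIdeal ≤ Q := (le_iff_of_isHomogeneous hlast).2 h
      have h2 : Q' < l.last := by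
        refine hQ1.trans_le ?_
        rw [← RelSeries.last_tail l hn0]
        exact LTSeries.head_le_last _
      exact not_lt_of_ge h1 h2
    obtain ⟨q, haq, hqlen, hqhead, hqlast⟩ :=
      PrimeSpectrum.exist_ltSeries_mem_one_of_mem_last l₁ (x := a) (hl₁last ▸ hal)
    have hq0 : q.length ≠ 0 := by omega
    have hqQ : q.head = Q' := hqhead ▸ RelSeries.head_cons ..
    have hI' : (Q ⊔ Ideal.span {a}).IsHomogeneous (grading N) :=
      hQhom.sup (Ideal.homogeneous_span _ _ (by
        rintro x rfl
        exact ⟨m, ham⟩))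
    obtain ⟨l', hlen, hlast', hhead', hhom⟩ := ih hI' (q.tail hq0) (by
      rw [RelSeries.head_tail]
      refine sup_le ?_ ((Ideal.span_singleton_le_iff_mem _).2 haq)
      have : q.head ≤ q 1 := q.strictMono.monotone (Fin.zero_le _)
      exact (hqQ ▸ this : Q' ≤ q 1)) (by
      rw [RelSeries.last_tail, ← hqlast, hl₁last]
      exact hlast) (by
      rw [RelSeries.tail_length]
      omega)
    have hlt : Q' < l'.head := by
      refine lt_of_le_of_ne (le_sup_left.trans hhead') fun h => haQ ?_
      have : a ∈ l'.head.asIdeal := hhead' (Ideal.mem_sup_right (Ideal.mem_span_singleton_self a))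
      rwa [← h] at this
    refine ⟨l'.cons Q' hlt, by simp [hlen], ?_, ?_, ?_⟩
    · rw [RelSeries.last_cons, hlast', RelSeries.last_tail, ← hqlast, hl₁last]
    · rw [RelSeries.head_cons]
      exact hQ.1.2
    · have key : ∀ z ∈ (l'.cons Q' hlt), z.asIdeal.IsHomogeneous (grading N) := by
        intro z hz
        rw [← RelSeries.mem_toList, RelSeries.toList_cons, List.mem_cons,
          RelSeries.mem_toList] at hz
        rcases hz with rfl | ⟨j, rfl⟩
        · exact hQhom
        · exact hhom j
      exact fun i => key _ ⟨i, rfl⟩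

noncomputable section

/-- The homogeneous prime ideal of a point of projective space. -/
def pointIdeal (x : ProjSpace N) : Ideal (S N) :=
  (show ProjectiveSpectrum (grading N) from x).asHomogeneousIdeal.toIdeal

instance isPrime_pointIdeal (x : ProjSpace N) : (pointIdeal x).IsPrime :=
  (show ProjectiveSpectrum (grading N) from x).isPrime

theorem isHomogeneous_pointIdeal (x : ProjSpace N) :
    (pointIdeal x).IsHomogeneous (grading N) :=
  (show ProjectiveSpectrum (grading N) from x).asHomogeneousIdeal.isHomogeneous

theorem not_irrelevant_le_pointIdeal (x : ProjSpace N) :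
    ¬ (HomogeneousIdeal.irrelevant (grading N)).toIdeal ≤ pointIdeal x :=
  (show ProjectiveSpectrum (grading N) from x).not_irrelevant_le

theorem exists_pointIdeal_eq {P : Ideal (S N)} (hP : P.IsPrime)
    (hhom : P.IsHomogeneous (grading N))
    (hne : ¬ (HomogeneousIdeal.irrelevant (grading N)).toIdeal ≤ P) :
    ∃ x : ProjSpace N, pointIdeal x = P :=
  ⟨show ProjectiveSpectrum (grading N) from ⟨⟨P, hhom⟩, hP, hne⟩, rfl⟩

/-- The order on points is specialization, which reverses inclusion of primes; this is why coheights
of points become heights of ideals. -/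
theorem le_iff_pointIdeal_le {x y : ProjSpace N} : x ≤ y ↔ pointIdeal y ≤ pointIdeal x := by
  change (y ⤳ x) ↔ _
  rw [specializes_iff_mem_closure]
  exact (ProjectiveSpectrum.le_iff_mem_closure (𝒜 := grading N) y x).symm

theorem lt_iff_pointIdeal_lt {x y : ProjSpace N} : x < y ↔ pointIdeal y < pointIdeal x := by
  rw [lt_iff_le_not_ge, lt_iff_le_not_ge, le_iff_pointIdeal_le, le_iff_pointIdeal_le]

/-- The codimension of a point of projective space is the height of its homogeneous prime. -/
theorem coheight_eq_height_pointIdeal (x : ProjSpace N) :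
    Order.coheight x = (pointIdeal x).height := by
  have hheight : (pointIdeal x).height =
      Order.height (⟨pointIdeal x, inferInstance⟩ : PrimeSpectrum (S N)) :=
    PrimeSpectrum.height_eq_orderHeight ⟨pointIdeal x, inferInstance⟩
  rw [hheight]
  apply le_antisymm
  · exact Order.height_le_height_apply_of_strictMono
      (α := (ProjSpace N)ᵒᵈ) (β := PrimeSpectrum (S N))
      (fun y => ⟨pointIdeal (OrderDual.ofDual y), inferInstance⟩)
      (fun y z h => (lt_iff_pointIdeal_lt.1 h : pointIdeal (OrderDual.ofDual y) < _))
      (OrderDual.toDual x)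
  -- A chain of primes below the ideal of `x` can be made homogeneous. Its members are then points,
  -- since the irrelevant ideal is not contained in the ideal of `x`.
  · refine ENat.forall_natCast_le_iff_le.1 fun n hn => ?_
    obtain ⟨l, hlast, hlen⟩ := Order.exists_series_of_le_height _ hn
    obtain ⟨l', hlen', hlast', -, hhom⟩ := exists_ltSeries_isHomogeneous
      (Ideal.IsHomogeneous.bot (grading N)) l bot_le (by
        rw [hlast]
        exact isHomogeneous_pointIdeal x)
    have hle : ∀ i, (l' i).asIdeal ≤ pointIdeal x := fun i => by
      have : l' i ≤ l'.last := l'.monotone (Fin.le_last i)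
      rw [hlast', hlast] at this
      exact this
    choose y hy using fun i => exists_pointIdeal_eq (l' i).2 (hhom i)
      fun h => not_irrelevant_le_pointIdeal x (h.trans (hle i))
    let m : LTSeries (ProjSpace N)ᵒᵈ := LTSeries.mk l'.length (fun i => OrderDual.toDual (y i))
      fun i j hij => by
        refine lt_iff_pointIdeal_lt.2 ?_
        change pointIdeal (y i) < pointIdeal (y j)
        rw [hy, hy]
        exact l'.strictMono hij
    have hm : x ≤ OrderDual.ofDual m.last := by
      refine le_iff_pointIdeal_le.2 ?_
      change pointIdeal (y (Fin.last _)) ≤ _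
      rw [hy]
      exact hle _
    have h1 : (m.length : ℕ∞) ≤ Order.height m.last := Order.length_le_height_last
    have h2 : Order.height m.last ≤ Order.height (OrderDual.toDual x) := Order.height_mono hm
    have h3 : m.length = n := hlen'.trans hlen
    rw [h3] at h1
    exact h1.trans h2

end

end Heights

/-! ### Ideal sheaves and their homogeneous ideals -/

section IdealSheaves

/-- A section over an affine open lies in a quasi-coherent ideal after multiplication by a power of
`f`, as soon as its restriction to the locus where `f` is invertible lies in the ideal. -/
theorem exists_pow_mul_mem_ideal {X : Scheme.{0}} (I : X.IdealSheafData) (U : X.affineOpens)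
    (f s : Γ(X, U.1))
    (h : (X.presheaf.map (homOfLE (X.basicOpen_le f)).op).hom s ∈ I.ideal (X.affineBasicOpen f)) :
    ∃ n : ℕ, f ^ n * s ∈ I.ideal U := by
  have inst := U.2.isLocalization_basicOpen f
  rw [← I.map_ideal_basicOpen] at h
  have h' : algebraMap Γ(X, U.1) Γ(X, X.basicOpen f) s ∈
    (I.ideal U).map (algebraMap Γ(X, U.1) Γ(X, X.basicOpen f)) := h
  obtain ⟨_, ⟨n, rfl⟩, hn⟩ :=
    (IsLocalization.algebraMap_mem_map_algebraMap_iff (Submonoid.powers f) _ _ _).1 h'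
  exact ⟨n, hn⟩

variable {N : ℕ}

theorem pow_mul_mem_grading {m : ℕ} (i : Fin (N + 1)) (e : ℕ) {f : S N} (hf : f ∈ grading N m) :
    MvPolynomial.X i ^ e * f ∈ grading N (e + m) := by
  refine SetLike.mul_mem_graded ?_ hf
  simpa using SetLike.pow_mem_graded e (X_mem_grading i)

theorem mem_chart_iff {i : Fin (N + 1)} {x : ProjSpace N} :
    x ∈ (chart i).1 ↔ MvPolynomial.X i ∉ pointIdeal x :=
  Iff.rfl

/-- The value of a section of the structure sheaf at a point, as a fraction. -/
noncomputable def fractionAt {U : (ProjSpace N).Opens} {x : ProjSpace N} (hx : x ∈ U) :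
    Γ(ProjSpace N, U) →+* Localization.AtPrime (pointIdeal x) where
  toFun s := (s.1 ⟨x, hx⟩).val
  map_one' := HomogeneousLocalization.val_one
  map_zero' := HomogeneousLocalization.val_zero
  map_mul' _ _ := HomogeneousLocalization.val_mul _ _
  map_add' _ _ := HomogeneousLocalization.val_add _ _

theorem section_ext {U : (ProjSpace N).Opens} {s t : Γ(ProjSpace N, U)}
    (h : ∀ (x : ProjSpace N) (hx : x ∈ U), fractionAt hx s = fractionAt hx t) : s = t :=
  Proj.ext (𝒜 := grading N) s t
    (funext fun x => HomogeneousLocalization.val_injective _ (h x.1 x.2))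

theorem fractionAt_res {U V : (ProjSpace N).Opens} (h : U ≤ V) {x : ProjSpace N} (hx : x ∈ U)
    (s : Γ(ProjSpace N, V)) :
    fractionAt hx (((ProjSpace N).presheaf.map (homOfLE h).op).hom s) = fractionAt (h hx) s :=
  rfl

theorem isUnit_fractionAt_iff {U : (ProjSpace N).Opens} {x : ProjSpace N} (hx : x ∈ U)
    (s : Γ(ProjSpace N, U)) : IsUnit (fractionAt hx s) ↔ x ∈ (ProjSpace N).basicOpen s := by
  rw [Scheme.mem_basicOpen _ _ _ hx]
  refine (HomogeneousLocalization.isUnit_iff_isUnit_val (𝒜 := grading N)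
    (𝔭 := pointIdeal x) (s.1 ⟨x, hx⟩)).trans ?_
  exact (iff_of_eq (congrArg IsUnit (Proj.stalkIso'_germ (grading N) U x hx s))).symm.trans
    (MulEquiv.isUnit_map (Proj.stalkIso' (grading N) x))

theorem fractionAt_dehomogenize {m : ℕ} (i : Fin (N + 1)) {f : S N} (hf : f ∈ grading N m)
    {x : ProjSpace N} (hx : x ∈ (chart i).1) :
    fractionAt hx (dehomogenize i f hf) = Localization.mk f
      (⟨MvPolynomial.X i ^ m, fun h => hx ((isPrime_pointIdeal x).mem_of_pow_mem m h)⟩ :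
        (pointIdeal x).primeCompl) := by
  change ((dehomogenize i f hf).1 ⟨x, hx⟩).val = _
  refine (ProjectiveSpectrum.Proj.awayToSection_apply (grading N) (MvPolynomial.X i) _
    ⟨x, hx⟩).trans ?_
  rw [HomogeneousLocalization.Away.val_mk, Localization.mk_eq_mk', IsLocalization.map_mk',
    ← Localization.mk_eq_mk']
  rfl

theorem dehomogenize_surjective (i : Fin (N + 1)) (s : Γ(ProjSpace N, (chart i).1)) :
    ∃ (m : ℕ) (f : S N) (hf : f ∈ grading N m), dehomogenize i f hf = s := by
  let e := Proj.basicOpenIsoAway (grading N) (MvPolynomial.X i) (X_mem_grading i) Nat.one_pos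
  obtain ⟨m, f, hf, h⟩ :=
    HomogeneousLocalization.Away.mk_surjective (grading N) (X_mem_grading i) (e.inv.hom s)
  refine ⟨m, f, by simpa only [smul_eq_mul, mul_one] using hf, ?_⟩
  change e.hom.hom (HomogeneousLocalization.Away.mk (grading N) (X_mem_grading i) m f hf) = s
  rw [h]
  exact congrArg (fun φ => φ.hom s) e.inv_hom_id

theorem mem_basicOpen_dehomogenize {m : ℕ} (i : Fin (N + 1)) {f : S N} (hf : f ∈ grading N m)
    {x : ProjSpace N} (hx : x ∈ (chart i).1) :
    x ∈ (ProjSpace N).basicOpen (dehomogenize i f hf) ↔ f ∉ pointIdeal x := by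
  rw [← isUnit_fractionAt_iff hx, fractionAt_dehomogenize, Localization.mk_eq_mk']
  exact IsLocalization.AtPrime.isUnit_mk'_iff _ (pointIdeal x) _ _

/-- The change of trivialization of 𝒪(m): f / X_j^m = (X_i / X_j)^m · f / X_i^m, checked as
fractions at every point. -/
theorem dehomogenize_res {m : ℕ} (i j : Fin (N + 1)) {f : S N} (hf : f ∈ grading N m)
    {U : (ProjSpace N).Opens} (hi : U ≤ (chart i).1) (hj : U ≤ (chart j).1) :
    ((ProjSpace N).presheaf.map (homOfLE hj).op).hom (dehomogenize j f hf) =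
      ((ProjSpace N).presheaf.map (homOfLE hj).op).hom
        (dehomogenize j (MvPolynomial.X i) (X_mem_grading i)) ^ m *
      ((ProjSpace N).presheaf.map (homOfLE hi).op).hom (dehomogenize i f hf) := by
  refine section_ext fun x hx => ?_
  rw [map_mul, map_pow, fractionAt_res, fractionAt_res, fractionAt_res, fractionAt_dehomogenize,
    fractionAt_dehomogenize, fractionAt_dehomogenize, Localization.mk_pow, Localization.mk_mul,
    Localization.mk_eq_mk_iff, Localization.r_iff_exists]
  refine ⟨1, ?_⟩
  simp only [OneMemClass.coe_one, one_mul, Submonoid.coe_mul, SubmonoidClass.coe_pow, pow_one]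
  ring

theorem dehomogenize_pow_mul {m : ℕ} (i j : Fin (N + 1)) (e : ℕ) {f : S N}
    (hf : f ∈ grading N m) :
    dehomogenize j (MvPolynomial.X i ^ e * f) (pow_mul_mem_grading i e hf) =
      dehomogenize j (MvPolynomial.X i) (X_mem_grading i) ^ e * dehomogenize j f hf := by
  refine section_ext fun x hx => ?_
  rw [map_mul, map_pow, fractionAt_dehomogenize,
    fractionAt_dehomogenize, fractionAt_dehomogenize, Localization.mk_pow, Localization.mk_mul,
    Localization.mk_eq_mk_iff, Localization.r_iff_exists]
  refine ⟨1, ?_⟩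
  simp only [OneMemClass.coe_one, one_mul, Submonoid.coe_mul, SubmonoidClass.coe_pow, pow_one]
  ring

theorem isHomogeneous_homogeneousIdeal (V : ClosedSubscheme N) :
    (homogeneousIdeal V).IsHomogeneous (grading N) :=
  Ideal.homogeneous_span _ _ fun _ ⟨m, hf, _⟩ => ⟨m, hf⟩

/-- A form whose trivialization on one chart is a section of the ideal sheaf lies in the
homogeneous ideal after multiplication by a power of the coordinate. -/
theorem exists_pow_mul_mem_homogeneousIdeal (V : ClosedSubscheme N) {m : ℕ} (i : Fin (N + 1))
    {f : S N} (hf : f ∈ grading N m) (h : dehomogenize i f hf ∈ V.ideal (chart i)) :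
    ∃ e : ℕ, MvPolynomial.X i ^ e * f ∈ homogeneousIdeal V := by
  -- On chart j, the locus where X_i / X_j is invertible lies in chart i. There f / X_j^m is a
  -- multiple of f / X_i^m, hence in the ideal, and a power of X_i / X_j extends this to all of
  -- chart j.
  have key : ∀ j, ∃ e : ℕ, dehomogenize j (MvPolynomial.X i) (X_mem_grading i) ^ e *
      dehomogenize j f hf ∈ V.ideal (chart j) := fun j => by
    refine exists_pow_mul_mem_ideal V (chart j) _ _ ?_
    set t := dehomogenize j (MvPolynomial.X i : S N) (X_mem_grading i) with ht
    have hi : (ProjSpace N).basicOpen t ≤ (chart i).1 := fun x hx => by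
      rw [mem_chart_iff]
      exact (mem_basicOpen_dehomogenize j (X_mem_grading i)
        ((ProjSpace N).basicOpen_le t hx)).1 hx
    rw [dehomogenize_res i j hf hi]
    refine Ideal.mul_mem_left _ _ ?_
    exact V.ideal_le_comap_ideal (U := (ProjSpace N).affineBasicOpen t) (V := chart i) hi h
  choose e he using key
  -- The sum of the exponents serves all charts at once.
  refine ⟨∑ j, e j, Ideal.subset_span ⟨_, pow_mul_mem_grading i _ hf, fun j => ?_⟩⟩
  rw [dehomogenize_pow_mul i j _ hf]
  have h1 : e j ≤ ∑ j, e j := Finset.single_le_sum (fun _ _ => Nat.zero_le _) (Finset.mem_univ j)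
  obtain ⟨d, hd⟩ := Nat.exists_eq_add_of_le' h1
  rw [hd, pow_add, mul_assoc]
  exact Ideal.mul_mem_left _ _ (he j)

/-- The support of a closed subscheme is the zero locus of its homogeneous ideal. -/
theorem mem_support_iff {V : ClosedSubscheme N} {x : ProjSpace N} :
    x ∈ V.support ↔ homogeneousIdeal V ≤ pointIdeal x := by
  obtain ⟨i, hi⟩ : ∃ i : Fin (N + 1), MvPolynomial.X i ∉ pointIdeal x := by
    by_contra! h
    refine not_irrelevant_le_pointIdeal x ?_
    rw [irrelevant_eq_span_range_X, Ideal.span_le]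
    rintro _ ⟨i, rfl⟩
    exact h i
  have hx : x ∈ (chart i).1 := hi
  rw [Scheme.IdealSheafData.mem_support_iff_of_mem (U := chart i) hx, Scheme.mem_zeroLocus_iff]
  refine ⟨fun h => Ideal.span_le.2 ?_, fun h s hs hxs => ?_⟩
  · rintro f ⟨m, hf, hfi⟩
    by_contra hfx
    exact h _ (hfi i) ((mem_basicOpen_dehomogenize i hf hx).2 hfx)
  · obtain ⟨m, f, hf, rfl⟩ := dehomogenize_surjective i s
    obtain ⟨e, he⟩ := exists_pow_mul_mem_homogeneousIdeal V i hf hs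
    refine (mem_basicOpen_dehomogenize i hf hx).1 hxs ?_
    exact ((isPrime_pointIdeal x).mem_or_mem (h he)).resolve_left
      fun h' => hi ((isPrime_pointIdeal x).mem_of_pow_mem e h')

/-- The sum of the two homogeneous ideals may fail to be saturated, but on each chart a section of
the sum of the sheaves is a sum of sections. Clearing denominators carries `f` into the sum by a
power of each variable; the radical of a colon ideal passes from the variables to any `y`. -/
theorem exists_pow_mul_mem_sup {Y Z : ClosedSubscheme N} {f : S N}
    (hf : f ∈ homogeneousIdeal (Y ⊔ Z)) {y : S N}
    (hy : y ∈ (HomogeneousIdeal.irrelevant (grading N)).toIdeal) :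
    ∃ e : ℕ, y ^ e * f ∈ homogeneousIdeal Y ⊔ homogeneousIdeal Z := by
  set L := homogeneousIdeal Y ⊔ homogeneousIdeal Z with hL
  have hX : ∀ i : Fin (N + 1), ∃ e : ℕ, MvPolynomial.X i ^ e * f ∈ L := fun i => by
    induction hf using Submodule.span_induction with
    | zero => exact ⟨0, by simp⟩
    | add f g _ _ hf hg =>
      obtain ⟨a, ha⟩ := hf
      obtain ⟨b, hb⟩ := hg
      have h1 : (MvPolynomial.X i : S N) ^ (a + b) * (f + g) =
          MvPolynomial.X i ^ b * (MvPolynomial.X i ^ a * f) +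
          MvPolynomial.X i ^ a * (MvPolynomial.X i ^ b * g) := by ring
      exact ⟨a + b, h1 ▸ L.add_mem (L.mul_mem_left _ ha) (L.mul_mem_left _ hb)⟩
    | smul r f _ hf =>
      obtain ⟨a, ha⟩ := hf
      refine ⟨a, ?_⟩
      rw [smul_eq_mul, mul_left_comm]
      exact L.mul_mem_left _ ha
    | mem f hf =>
      obtain ⟨m, hf, hfi⟩ := hf
      obtain ⟨s, hs, t, ht, hst⟩ := Submodule.mem_sup.1 (hfi i)
      obtain ⟨k, a, ha, rfl⟩ := dehomogenize_surjective i s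
      obtain ⟨l, b, hb, rfl⟩ := dehomogenize_surjective i t
      obtain ⟨c, hc⟩ := exists_pow_mul_mem_homogeneousIdeal Y i ha hs
      obtain ⟨d, hd⟩ := exists_pow_mul_mem_homogeneousIdeal Z i hb ht
      have key : (MvPolynomial.X i : S N) ^ (k + l) * f =
          MvPolynomial.X i ^ (m + l) * a + MvPolynomial.X i ^ (m + k) * b := by
        -- At the generic point, an equality of fractions is an equality of polynomials after
        -- cross-multiplication, as S is a domain.
        obtain ⟨x, hx⟩ := exists_pointIdeal_eq (Ideal.isPrime_bot (α := S N))
          (Ideal.IsHomogeneous.bot (grading N)) fun h =>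
            MvPolynomial.X_ne_zero i (h (irrelevant_eq_span_range_X N ▸
              Ideal.subset_span ⟨i, rfl⟩))
        have hxi : x ∈ (chart i).1 := by
          rw [mem_chart_iff, hx]
          exact MvPolynomial.X_ne_zero i
        have h1 := congrArg (fractionAt hxi) hst
        rw [map_add, fractionAt_dehomogenize, fractionAt_dehomogenize, fractionAt_dehomogenize,
          Localization.add_mk, Localization.mk_eq_mk_iff, Localization.r_iff_exists] at h1
        obtain ⟨c, hc⟩ := h1
        have hc0 : (c : S N) ≠ 0 := fun h => c.2 (h ▸ zero_mem _)
        have h2 := mul_left_cancel₀ hc0 hc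
        simp only [Submonoid.coe_mul] at h2
        linear_combination -h2
      refine ⟨c + d + (k + l), ?_⟩
      rw [pow_add, mul_assoc, key]
      have e1 : (MvPolynomial.X i : S N) ^ (c + d) *
          (MvPolynomial.X i ^ (m + l) * a + MvPolynomial.X i ^ (m + k) * b) =
          MvPolynomial.X i ^ (d + (m + l)) * (MvPolynomial.X i ^ c * a) +
          MvPolynomial.X i ^ (c + (m + k)) * (MvPolynomial.X i ^ d * b) := by ring
      rw [e1]
      exact L.add_mem (L.mul_mem_left _ (le_sup_left (a := homogeneousIdeal Y) hc))
        (L.mul_mem_left _ (le_sup_right (b := homogeneousIdeal Z) hd))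
  have h2 : (HomogeneousIdeal.irrelevant (grading N)).toIdeal ≤
      (L.colon (Ideal.span {f} : Ideal (S N))).radical := by
    rw [irrelevant_eq_span_range_X, Ideal.span_le]
    rintro _ ⟨i, rfl⟩
    obtain ⟨e, he⟩ := hX i
    exact ⟨e, Ideal.mem_colon_span_singleton.2 he⟩
  obtain ⟨e, he⟩ := h2 hy
  exact ⟨e, Ideal.mem_colon_span_singleton.1 he⟩

end IdealSheaves

/-! ### Codimension in projective space versus dimension at the vertex of the cone -/

section Dimension

variable {N : ℕ}

theorem height_comap_vertexRing (P : PrimeSpectrum (VertexRing N)) :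
    (P.asIdeal.comap (algebraMap (S N) (VertexRing N))).height = Order.height P := by
  rw [← PrimeSpectrum.height_eq_orderHeight]
  exact IsLocalization.height_under
    (HomogeneousIdeal.irrelevant (grading N)).toIdeal.primeCompl P.asIdeal

theorem height_irrelevant_le (N : ℕ) :
    (HomogeneousIdeal.irrelevant (grading N)).toIdeal.height ≤ (N + 1 : ℕ) := by
  have h1 := (HomogeneousIdeal.irrelevant (grading N)).toIdeal.height_le_ringKrullDim_of_isPrime
  have h2 : ringKrullDim (S N) = ((N + 1 : ℕ) : ℕ∞) := by
    rw [MvPolynomial.ringKrullDim_of_isNoetherianRing, ringKrullDim_eq_zero_of_field, zero_add,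
      Nat.card_eq_fintype_card, Fintype.card_fin]
    rfl
  rw [h2] at h1
  exact WithBot.coe_le_coe.1 h1

theorem height_add_coheight_vertexRing_le (P : PrimeSpectrum (VertexRing N)) :
    Order.height P + Order.coheight P ≤ (N + 1 : ℕ) := by
  have h1 : Order.krullDim (PrimeSpectrum (VertexRing N)) ≤ ((N + 1 : ℕ) : ℕ∞) := by
    refine (IsLocalization.AtPrime.ringKrullDim_eq_height
      (HomogeneousIdeal.irrelevant (grading N)).toIdeal (VertexRing N)).le.trans ?_
    exact WithBot.coe_le_coe.2 (height_irrelevant_le N)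
  rw [Order.krullDim_eq_iSup_height_add_coheight_of_nonempty, WithBot.coe_le_coe] at h1
  exact (le_iSup (fun P : PrimeSpectrum (VertexRing N) => Order.height P + Order.coheight P)
    P).trans h1

theorem pointIdeal_lt_irrelevant (x : ProjSpace N) :
    pointIdeal x < (HomogeneousIdeal.irrelevant (grading N)).toIdeal :=
  lt_of_le_not_ge (le_irrelevant_of_isHomogeneous (isHomogeneous_pointIdeal x)
    (isPrime_pointIdeal x).ne_top) (not_irrelevant_le_pointIdeal x)

/-- The prime of a point lies strictly inside the irrelevant ideal. For nonempty X this makes the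
cone over X at least one-dimensional. -/
theorem coheight_lt (x : ProjSpace N) : Order.coheight x < (N + 1 : ℕ) := by
  rw [coheight_eq_height_pointIdeal]
  refine lt_of_lt_of_le ?_ (height_irrelevant_le N)
  exact Ideal.height_strict_mono_of_isPrime_of_isPrime (pointIdeal_lt_irrelevant x)

/-- The point of the spectrum of the local ring at the vertex of the cone given by a point. -/
theorem exists_comap_vertexRing_eq_pointIdeal (x : ProjSpace N) :
    ∃ P : PrimeSpectrum (VertexRing N),
      P.asIdeal.comap (algebraMap (S N) (VertexRing N)) = pointIdeal x := by
  have hd : Disjoint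
      ((HomogeneousIdeal.irrelevant (grading N)).toIdeal.primeCompl : Set (S N))
      (pointIdeal x : Set (S N)) :=
    Set.disjoint_left.2 fun f hf hfx => hf ((pointIdeal_lt_irrelevant x).le hfx)
  exact ⟨⟨_, IsLocalization.isPrime_of_isPrime_disjoint _ (VertexRing N) _
    (isPrime_pointIdeal x) hd⟩,
    IsLocalization.under_map_of_isPrime_disjoint _ (VertexRing N) (isPrime_pointIdeal x) hd⟩

/-- A bound for the dimension of the affine cone gives a bound for the codimension. -/
theorem le_add_codim {V : ClosedSubscheme N} {p : ℕ}
    (h : ∀ P : PrimeSpectrum (VertexRing N),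
      (homogeneousIdeal V).map (algebraMap (S N) (VertexRing N)) ≤ P.asIdeal →
        Order.coheight P ≤ p) : ((N + 1 : ℕ) : ℕ∞) ≤ p + codim V := by
  rw [← tsub_le_iff_left]
  refine le_iInf₂ fun x hx => ?_
  rw [tsub_le_iff_left]
  obtain ⟨P, hP⟩ := exists_comap_vertexRing_eq_pointIdeal x
  have h1 := (hasRegularSequence_vertexRing N).le_height_add_coheight P
  rw [← height_comap_vertexRing, hP, ← coheight_eq_height_pointIdeal] at h1
  refine h1.trans ((add_comm _ _).le.trans (add_le_add_left ?_ _))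
  refine h P (Ideal.map_le_iff_le_comap.2 ?_)
  rw [hP]
  exact mem_support_iff.1 hx

/-- The dimension of the affine cone over an intersection is bounded in terms of the
codimension of the intersection. -/
theorem coheight_le_of_codim {Y Z : ClosedSubscheme N} {r : ℕ}
    (hr : ((N + 1 : ℕ) : ℕ∞) ≤ r + codim (Y ⊔ Z)) (P : PrimeSpectrum (VertexRing N))
    (hY : (homogeneousIdeal Y).map (algebraMap (S N) (VertexRing N)) ≤ P.asIdeal)
    (hZ : (homogeneousIdeal Z).map (algebraMap (S N) (VertexRing N)) ≤ P.asIdeal) :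
    Order.coheight P ≤ r := by
  rw [Ideal.map_le_iff_le_comap] at hY hZ
  set Q := P.asIdeal.comap (algebraMap (S N) (VertexRing N)) with hQ
  have hQprime : Q.IsPrime := Ideal.comap_isPrime _ _
  -- `P` need not come from a homogeneous prime. Its homogeneous core still contains both ideals and
  -- either is a point of the intersection, whose codimension bounds the height of `P` from below,
  -- or contains the irrelevant ideal, which makes `P` maximal.
  set C := (Q.homogeneousCore (grading N)).toIdeal with hC
  have hCQ : C ≤ Q := Q.toIdeal_homogeneousCore_le (grading N)
  have hCprime : C.IsPrime := hQprime.homogeneousCore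
  have hcore : ∀ V : ClosedSubscheme N, homogeneousIdeal V ≤ Q → homogeneousIdeal V ≤ C :=
    fun V hV => by
      rw [← (isHomogeneous_homogeneousIdeal V).toIdeal_homogeneousCore_eq_self]
      exact Ideal.homogeneousCore_mono (grading N) hV
  by_cases hirr : (HomogeneousIdeal.irrelevant (grading N)).toIdeal ≤ C
  · have hmax : IsMax P := by
      have h1 : IsLocalRing.maximalIdeal (VertexRing N) ≤ P.asIdeal := by
        rw [← IsLocalization.AtPrime.map_eq_maximalIdeal
          (HomogeneousIdeal.irrelevant (grading N)).toIdeal (VertexRing N),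
          Ideal.map_le_iff_le_comap]
        exact hirr.trans hCQ
      intro P' _
      exact (IsLocalRing.le_maximalIdeal P'.2.ne_top).trans h1
    rw [Order.coheight_eq_zero.2 hmax]
    exact zero_le
  · obtain ⟨x, hx⟩ := exists_pointIdeal_eq hCprime
      (Q.homogeneousCore (grading N)).isHomogeneous hirr
    have hxYZ : x ∈ (Y ⊔ Z).support := by
      rw [Scheme.IdealSheafData.support_sup]
      exact ⟨mem_support_iff.2 (hx ▸ hcore Y hY), mem_support_iff.2 (hx ▸ hcore Z hZ)⟩
    have h1 : codim (Y ⊔ Z) ≤ Order.height P :=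
      calc codim (Y ⊔ Z) ≤ Order.coheight x := iInf₂_le x hxYZ
        _ = C.height := by rw [coheight_eq_height_pointIdeal, hx]
        _ ≤ Q.height := Ideal.height_mono hCQ
        _ = Order.height P := height_comap_vertexRing P
    have h2 := height_add_coheight_vertexRing_le P
    have hfin : Order.height P ≠ ⊤ := ne_top_of_le_ne_top (ENat.natCast_ne_top _)
      (le_self_add.trans h2)
    refine (ENat.add_le_add_iff_left hfin).1 (h2.trans (hr.trans ?_))
    rw [add_comm]
    gcongr

end Dimension

/-! ### Assembling the numerical hypotheses -/

/-- Over a local ring of the cone, a Cohen–Macaulay coordinate ring has a regular sequence that is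
as long as its dimension. -/
theorem exists_hasRegularSequence_localizedModule {N : ℕ} {V : ClosedSubscheme N}
    (hV : IsArithmeticallyCohenMacaulay V)
    (hirr : homogeneousIdeal V ≤ (HomogeneousIdeal.irrelevant (grading N)).toIdeal) :
    ∃ p : ℕ, HasRegularSequence (VertexRing N)
      ((ModuleCat.of (S N) (S N ⧸ homogeneousIdeal V)).localizedModule
        (HomogeneousIdeal.irrelevant (grading N)).toIdeal.primeCompl) p ∧
      ∀ P : PrimeSpectrum (VertexRing N),
        (homogeneousIdeal V).map (algebraMap _ (VertexRing N)) ≤ P.asIdeal →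
          Order.coheight P ≤ p := by
  set 𝔪 := (HomogeneousIdeal.irrelevant (grading N)).toIdeal
  obtain ⟨p, hp, hdim⟩ := exists_hasRegularSequence_of_isCohenMacaulayRing hirr hV
  refine ⟨p, ?_, hdim⟩
  let E := ModuleCat.of (S N) (S N ⧸ homogeneousIdeal V)
  let M : ModuleCat.{0} (VertexRing N) := E.localizedModule 𝔪.primeCompl
  let _ : Module (S N) M := inferInstanceAs (Module (S N) (E.localizedModule 𝔪.primeCompl))
  have : IsScalarTower (S N) (VertexRing N) M :=
    inferInstanceAs (IsScalarTower (S N) (Localization 𝔪.primeCompl)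
      (E.localizedModule 𝔪.primeCompl))
  let ι : S N ⧸ homogeneousIdeal V →ₗ[S N] M := E.localizedModuleMkLinearMap 𝔪.primeCompl
  have hι : IsLocalizedModule 𝔪.primeCompl ι :=
    ModuleCat.localizedModule_isLocalizedModule E 𝔪.primeCompl
  exact hp M ι

/-- The main theorem for one of the two closed subschemes. -/
theorem isPGShell_sup_left {N : ℕ} {Y Z : ClosedSubscheme N}
    (hY : IsArithmeticallyCohenMacaulay Y) (hZ : IsArithmeticallyCohenMacaulay Z)
    (hne : ((Y ⊔ Z).support : Set (ProjSpace N)).Nonempty)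
    (hcodim : codim (Y ⊔ Z) = codim Y + codim Z) : IsPGShell Y (Y ⊔ Z) := by
  obtain ⟨x, hx⟩ := hne
  have hxirr : homogeneousIdeal (Y ⊔ Z) ≤ (HomogeneousIdeal.irrelevant (grading N)).toIdeal :=
    (mem_support_iff.1 hx).trans (pointIdeal_lt_irrelevant x).le
  have hYirr := (homogeneousIdeal_mono (le_sup_left : Y ≤ Y ⊔ Z)).trans hxirr
  have hZirr := (homogeneousIdeal_mono (le_sup_right : Z ≤ Y ⊔ Z)).trans hxirr
  obtain ⟨p, hp, hpdim⟩ := exists_hasRegularSequence_localizedModule hY hYirr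
  obtain ⟨q, hq, hqdim⟩ := exists_hasRegularSequence_localizedModule hZ hZirr
  have hXlt : codim (Y ⊔ Z) < (N + 1 : ℕ) := (iInf₂_le x hx).trans_lt (coheight_lt x)
  obtain ⟨c, hc⟩ := ENat.ne_top_iff_exists.1 hXlt.ne_top
  have hYtop : codim Y ≠ ⊤ := ne_top_of_le_ne_top hXlt.ne_top (hcodim ▸ le_self_add)
  have hZtop : codim Z ≠ ⊤ := ne_top_of_le_ne_top hXlt.ne_top (hcodim ▸ le_add_self)
  obtain ⟨a, ha⟩ := ENat.ne_top_iff_exists.1 hYtop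
  obtain ⟨b, hb⟩ := ENat.ne_top_iff_exists.1 hZtop
  have hpa := le_add_codim hpdim
  have hqb := le_add_codim hqdim
  rw [← ha] at hpa hcodim
  rw [← hb] at hqb hcodim
  rw [← hc] at hXlt hcodim
  norm_cast at hpa hqb hXlt hcodim
  refine ⟨le_sup_left, fun t _ => (ModuleCat.mono_iff_injective _).1 ?_⟩
  -- With a, b, c the codimensions of Y, Z, X, the bounds p ≥ N + 1 - a, q ≥ N + 1 - b and c = a + b
  -- give p + q ≥ (N + 1) + r for r = N + 1 - c. Truncating `q` at N + 1 ensures q ≤ N + 1 and costs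
  -- nothing, because p ≥ r.
  refine mono_tor'_map_factor (J := homogeneousIdeal Z) (p := p) (q := min q (N + 1))
    (r := N + 1 - c) (homogeneousIdeal_mono le_sup_left) hZirr
    (fun f hf y hy => exists_pow_mul_mem_sup hf hy) (min_le_right _ _) (by omega) (by omega)
    hp (hq.mono (min_le_left _ _)) (fun P h1 h2 => coheight_le_of_codim ?_ P h1 h2) t
  rw [← hc]
  norm_cast
  omega

end PGShell

theorem proposition1p4 (N : ℕ) (Y Z : PGShell.ClosedSubscheme N)
    (hY : PGShell.IsArithmeticallyCohenMacaulay Y)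
    (hZ : PGShell.IsArithmeticallyCohenMacaulay Z)
    (hne : (((PGShell.inter Y Z).support : Set (PGShell.ProjSpace N))).Nonempty)
    (hcodim : PGShell.codim (PGShell.inter Y Z) = PGShell.codim Y + PGShell.codim Z) :
    PGShell.IsPGShell Y (PGShell.inter Y Z) ∧ PGShell.IsPGShell Z (PGShell.inter Y Z) := by
  have hswap : PGShell.inter Y Z = Z ⊔ Y := sup_comm Y Z
  refine ⟨PGShell.isPGShell_sup_left hY hZ hne hcodim, ?_⟩
  rw [hswap] at hne hcodim ⊢
  exact PGShell.isPGShell_sup_left hZ hY hne (hcodim.trans (add_comm _ _))
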